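/- Fix integers $\ell,n_c\ge 1$, a Rician factor $\kappa\ge 0$, an SNR $\rho>0$ and an error probability $\epsilon\in[0,1)$, and set $\mu_H=\sqrt{\kappa/(1+\kappa)}$ and $\sigma_H^2=(1+\kappa)^{-1}$. Consider the single-input single-output Rician memoryless block-fading channel without a priori channel state information $$Y_k=H_kx_k+W_k,\qquad k=1,\dots,\ell,$$ with $x_k,Y_k\in\mathbb C^{n_c}$, $H_k\sim\mathcal{CN}(\mu_H,\sigma_H^2)$ and $W_k\sim\mathcal{CN}(0,I_{n_c})$, all $H_1,\dots,H_\ell,W_1,\dots,W_\ell$ being independent. An $(\ell,n_c,M,\epsilon,\rho)$-code consists of $M\ge 1$ codewords $c_m=(c_{m,1},\dots,c_{m,\ell})$ with $c_{m,k}\in\mathbb C^{n_c}$ and $\|c_{m,k}\|^2=n_c\rho$ for all $m,k$, and a decoder $g:\mathbb C^{n_c\ell}\to\{1,\dots,M\}$, a function of the channel output only, such that $\frac1M\sum_{j=1}^M\Pr\{g(Y^\ell)\ne j\mid x^\ell=c_j\}\le\epsilon$. Let $$R^*(\ell,n_c,\epsilon,\rho)=\sup\Big\{\frac{\log_2M}{\ell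 n_c}:\ \text{an }(\ell,n_c,M,\epsilon,\rho)\text{-code exists}\Big\}.$$ **Theorem (RCUs noncoherent achievability bound).** The following maximum exists and satisfies $$R^*(\ell,n_c,\epsilon,\rho)\ \ge\ \max\Big\{\frac{\log_2 M}{n_c\ell}:\ M\in\{1,2,\dots\},\ \epsilon_{\rm ub}(\ell,n_c,M,\rho)\le\epsilon\Big\},$$ where $$\epsilon_{\rm ub}(\ell,n_c,M,\rho)=\inf_{s\ge0}\mathbb E\Big[\exp\Big\{-\Big[\sum_{k=1}^{\ell}S_k^s-\log(M-1)\Big]^+\Big\}\Big],\qquad [a]^+=\max\{0,a\},$$ with the conventions $\log 0=-\infty$ and $\exp(-\infty)=0$ (so that $\epsilon_{\rm ub}=0$ for $M=1$). Here, for $s>0$, $$\begin{aligned}S_k^s={}&(n_c-2)\log s-\log\frac{1+\sigma_H^2n_c\rho}{\sigma_H^2}-\log\Gamma(n_c)-s\big(\|W_k\|^2-\|\widetilde W_k\|^2\big)+\frac{s|\mu_H|^2}{\sigma_H^2}\\&-\log\int_0^\infty\frac{\exp\{-s(\rho n_c+\sigma_H^{-2})z\}}{\big(\|\widetilde W_k\|\sqrt{\rho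 n_cz}\big)^{n_c-1}}\,I_{n_c-1}\big(2s\|\widetilde W_k\|\sqrt{\rho n_cz}\big)\,I_0\big(2s\sigma_H^{-2}\sqrt{z|\mu_H|^2}\big)\,dz,\end{aligned}$$ $S_k^0=0$ (the limit of $S_k^s$ as $s\downarrow0$), $I_\nu$ is the modified Bessel function of the first kind, the $W_k$ are the noise vectors above, and $\widetilde W_k$ is obtained from $W_k$ by replacing its first entry $W_{k,1}$ with $\mu_H\sqrt{n_c\rho}+\sqrt{\sigma_H^2n_c\rho+1}\;W_{k,1}$. -/

import Mathlib

open MeasureTheory ProbabilityTheory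
open scoped ENNReal

namespace RicianBlockFading

noncomputable section

/-- Vectors of `ℂ^nc` with the `l²`-norm: the symbols of one coherence block. -/
abbrev Block (nc : ℕ) : Type := EuclideanSpace ℂ (Fin nc)

/-- Mean of the Rician fading coefficient with Rician factor `κ`. -/
def muH (κ : ℝ) : ℝ := Real.sqrt (κ / (1 + κ))

/-- Variance of the Rician fading coefficient with Rician factor `κ`. -/
def sigmaH2 (κ : ℝ) : ℝ := (1 + κ)⁻¹

/-- The circularly-symmetric complex Gaussian law with mean `m` and variance `v`: independent real
and imaginary parts, each of variance `v / 2`. -/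
def complexGaussian (m : ℂ) (v : ℝ) : Measure ℂ :=
  ((gaussianReal m.re (v / 2).toNNReal).prod (gaussianReal m.im (v / 2).toNNReal)).map
    (fun p : ℝ × ℝ => (⟨p.1, p.2⟩ : ℂ))

/-- The law of the additive noise in one block: standard circularly-symmetric complex Gaussian
with covariance the identity matrix of size `nc`. -/
def noise (nc : ℕ) : Measure (Block nc) :=
  (Measure.pi (fun _ : Fin nc => complexGaussian 0 1)).map (WithLp.toLp 2)

/-- The law of the output `(Y_1, …, Y_ℓ)`, `Y_k = H_k x_k + W_k`, for the input `x = (x_1, …, x_ℓ)`.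
All `H_k` and `W_k` are independent. -/
def channelLaw (κ : ℝ) {ℓ nc : ℕ} (x : Fin ℓ → Block nc) : Measure (Fin ℓ → Block nc) :=
  (Measure.pi (fun _ : Fin ℓ =>
      (complexGaussian (muH κ : ℂ) (sigmaH2 κ)).prod (noise nc))).map
    (fun (hw : Fin ℓ → ℂ × Block nc) (k : Fin ℓ) => (hw k).1 • x k + (hw k).2)

/-- An `(ℓ, nc, M, ε, ρ)`-code for the Rician block-fading channel with Rician factor `κ`. The
decoder sees only the channel output. (`M = 0` is impossible: there is no decoder.) -/
structure Code (κ : ℝ) (ℓ nc M : ℕ) (ε ρ : ℝ) where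
  encoder : Fin M → Fin ℓ → Block nc
  power : ∀ m k, ‖encoder m k‖ ^ 2 = nc * ρ
  decoder : (Fin ℓ → Block nc) → Fin M
  measurable_decoder : Measurable decoder
  avg_error : (1 / (M : ℝ)) *
    ∑ j : Fin M, (channelLaw κ (encoder j)).real {y | decoder y ≠ j} ≤ ε

/-- The maximum coding rate, as a supremum in the extended reals. -/
def maxRate (κ : ℝ) (ℓ nc : ℕ) (ε ρ : ℝ) : EReal :=
  sSup {R : EReal | ∃ M : ℕ, Nonempty (Code κ ℓ nc M ε ρ) ∧
    R = ((Real.logb 2 M / (ℓ * nc) : ℝ) : EReal)}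

/-- The modified Bessel function of the first kind `I_n`, of order `n = 0, 1, 2, …`. -/
def besselI (n : ℕ) (x : ℝ) : ℝ :=
  ∑' j : ℕ, (x / 2) ^ (2 * j + n) / ((j.factorial : ℝ) * ((j + n).factorial : ℝ))

/-- The vector `[μ √(nc ρ), 0, …, 0] + [√(σ² nc ρ + 1), 1, …, 1] ⊙ w`. -/
def wTilde (κ ρ : ℝ) {nc : ℕ} (w : Block nc) : Block nc :=
  WithLp.toLp 2 (fun i : Fin nc =>
    if i.val = 0 then
      ((muH κ * Real.sqrt (nc * ρ) : ℝ) : ℂ) + (Real.sqrt (sigmaH2 κ * nc * ρ + 1) : ℂ) * w i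
    else w i)

/-- The integral over `z ∈ (0, ∞)` in the definition of `S_k^s`, as a function of `a = ‖w̃_k‖`. -/
def besselIntegral (κ ρ : ℝ) (nc : ℕ) (s a : ℝ) : ℝ :=
  ∫ z in Set.Ioi (0 : ℝ),
    Real.exp (-s * (ρ * nc + (sigmaH2 κ)⁻¹) * z) / (a * Real.sqrt (ρ * nc * z)) ^ (nc - 1)
      * besselI (nc - 1) (2 * s * a * Real.sqrt (ρ * nc * z))
      * besselI 0 (2 * s * (sigmaH2 κ)⁻¹ * Real.sqrt (z * |muH κ| ^ 2))

/-- The random variable `S_k^s` as a function of the noise `w` in block `k`. The explicit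
expression makes sense for `s > 0`; the value at `s = 0` is its limit as `s` tends to `0` from the
right, which is `0`. -/
def S (κ ρ : ℝ) {nc : ℕ} (s : ℝ) (w : Block nc) : ℝ :=
  if s = 0 then 0 else
    ((nc : ℝ) - 2) * Real.log s
      - Real.log ((1 + sigmaH2 κ * nc * ρ) / sigmaH2 κ)
      - Real.log (Real.Gamma nc)
      - s * (‖w‖ ^ 2 - ‖wTilde κ ρ w‖ ^ 2)
      + s * |muH κ| ^ 2 / sigmaH2 κ
      - Real.log (besselIntegral κ ρ nc s ‖wTilde κ ρ w‖)

/-- The error bound `inf_{s ≥ 0} E[exp(-[∑ₖ S_k^s - log (M - 1)]⁺)]`. Logarithm and exponential are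
the extended ones, so `log 0 = -∞` and `exp (-∞) = 0` when `M = 1`. -/
def errorBound (κ : ℝ) (ℓ nc M : ℕ) (ρ : ℝ) : ℝ≥0∞ :=
  ⨅ (s : ℝ) (_ : 0 ≤ s),
    ∫⁻ w : Fin ℓ → Block nc,
      EReal.exp (-(max 0 (((∑ k, S κ ρ s (w k) : ℝ) : EReal) - ENNReal.log ((M - 1 : ℕ) : ℝ≥0∞))))
      ∂(Measure.pi (fun _ : Fin ℓ => noise nc))

end

end RicianBlockFading

/-!
The bound is Shannon's random coding argument, run with independent codeword blocks that are uniform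
on the sphere of squared radius `nc * ρ`.

Given the input `x`, one block of the output is complex Gaussian, and its log-likelihood is
`-misfit κ x y` up to a constant that is the same for all inputs of the same norm. Decoding by
minimizing the total misfit, and averaging over the code, gives a code with `m + 1` codewords whose
error is at most `unionBound`, the expectation of `min 1 (m F)`, where `F` is the conditional
probability that an independent codeword fits the output at least as well as the true one
(`exists_code_le_unionBound`). By Markov's inequality `F` is at most the product over the blocks of
the ratios of the averaged to the true likelihood, both raised to the power `s`, for every `s ≥ 0`
(`inputLaw_le_prod_likelihoodRatio`). Since one code serves all `s` at once, it does not matter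
whether the infimum in `errorBound` is attained.

The remaining point is that these ratios are distributed like `exp (-S)`. The law of the noise is
invariant under unitary maps, so the input may be moved to the first coordinate axis, and the output
then has the law of `wTilde` (`blockLaw_eq_map_wTilde`, by characteristic functions). To average the
likelihood over the sphere, it is written as a Gaussian mixture over the fading coefficient
(`lintegral_exp_fading`); the average over the sphere and the integral over the phase of the fading
coefficient are then exponential moments of uniform laws on spheres. Those are Bessel functions
(`lintegral_exp_inner_sphere`): in polar coordinates the moments of the Gaussian weight
`exp (-‖x‖²)` factor into a radial and a spherical part, and their generating function
`∫ exp (2 ⟪b, x⟫ - ‖x‖²)` is `exp (‖b‖²)` times a constant. This yields `ofReal_exp_neg_S`.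

The maximum exists because only finitely many `M` are admissible. Indeed `errorBound` is at least
`unionBound`, uniformly in `s`, and `unionBound` increases to `1` with the number of codewords,
because `F` is almost surely positive: this holds for an output that is independent of the input by
`measure_setOf_measure_le_eq_zero`, and the law of the output given any input is absolutely
continuous.
-/

namespace RicianBlockFading

/-! ### Exponential moments of the uniform law on a sphere -/

/-- Uniqueness of the coefficients of a real power series. -/
lemma coeff_eq_of_hasSum {a b : ℕ → ℝ} {f : ℝ → ℝ}
    (ha : ∀ᶠ t in nhds (0 : ℝ), HasSum (fun k => a k * t ^ k) (f t))
    (hb : ∀ᶠ t in nhds (0 : ℝ), HasSum (fun k => b k * t ^ k) (f t)) : a = b := by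
  have key : ∀ c : ℕ → ℝ, (∀ᶠ t in nhds (0 : ℝ), HasSum (fun k => c k * t ^ k) (f t)) →
      HasFPowerSeriesAt f (FormalMultilinearSeries.ofScalars ℝ c) 0 := by
    intro c hc
    rw [hasFPowerSeriesAt_iff]
    filter_upwards [hc] with t ht
    simpa [FormalMultilinearSeries.coeff_ofScalars, mul_comm] using ht
  have h := (key a ha).eq_formalMultilinearSeries (key b hb)
  exact (FormalMultilinearSeries.ofScalars_series_eq_iff ℝ a b).1 h

section Sphere

set_option linter.unusedSectionVars false

variable {E : Type*} [NormedAddCommGroup E] [InnerProductSpace ℝ E] [FiniteDimensional ℝ E]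
  [MeasurableSpace E] [BorelSpace E] [Nontrivial E] (μ : Measure E) [μ.IsAddHaarMeasure]

/-- Polar coordinates, as an integral over the product of the sphere and the radii. -/
lemma lintegral_polar_prod {f : E → ℝ≥0∞} :
    ∫⁻ x, f x ∂μ =
      ∫⁻ p, f (p.2.1 • (p.1 : E))
        ∂(μ.toSphere.prod (Measure.volumeIoiPow (Module.finrank ℝ E - 1))) := by
  calc ∫⁻ x, f x ∂μ = ∫⁻ x in ({0}ᶜ : Set E), f x ∂μ := by
        rw [restrict_compl_singleton]
    _ = ∫⁻ x : ({0}ᶜ : Set E), f x.1 ∂(μ.comap (↑)) :=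
        (lintegral_subtype_comap (measurableSet_singleton (0 : E)).compl f).symm
    _ = _ := by
        rw [← μ.measurePreserving_homeomorphUnitSphereProd.lintegral_comp_emb
          (Homeomorph.measurableEmbedding _)]
        refine lintegral_congr fun x => ?_
        congr 1
        have hx : ‖(x : E)‖ ≠ 0 := norm_ne_zero_iff.2 x.2
        simp [smul_smul, hx]

lemma integral_polar_prod {f : E → ℝ} :
    ∫ x, f x ∂μ =
      ∫ p, f (p.2.1 • (p.1 : E))
        ∂(μ.toSphere.prod (Measure.volumeIoiPow (Module.finrank ℝ E - 1))) := by
  calc ∫ x, f x ∂μ = ∫ x in ({0}ᶜ : Set E), f x ∂μ := by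
        rw [restrict_compl_singleton]
    _ = ∫ x : ({0}ᶜ : Set E), f x.1 ∂(μ.comap (↑)) :=
        (integral_subtype_comap (measurableSet_singleton (0 : E)).compl f).symm
    _ = _ := by
        rw [← μ.measurePreserving_homeomorphUnitSphereProd.integral_comp
          (Homeomorph.measurableEmbedding _)]
        refine integral_congr_ae (.of_forall fun x => ?_)
        have hx : ‖(x : E)‖ ≠ 0 := norm_ne_zero_iff.2 x.2
        simp [smul_smul, hx]

lemma lintegral_volumeIoiPow (n : ℕ) {g : ℝ → ℝ≥0∞} (hg : Measurable g) :
    ∫⁻ r, g r.1 ∂Measure.volumeIoiPow n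
      = ∫⁻ r in Set.Ioi (0 : ℝ), ENNReal.ofReal (r ^ n) * g r := by
  rw [Measure.volumeIoiPow, lintegral_withDensity_eq_lintegral_mul _ (by fun_prop) (by fun_prop)]
  simp only [Pi.mul_apply]
  exact lintegral_subtype_comap measurableSet_Ioi (fun r : ℝ => ENNReal.ofReal (r ^ n) * g r)

lemma integral_volumeIoiPow (n : ℕ) {g : ℝ → ℝ} :
    ∫ r, g r.1 ∂Measure.volumeIoiPow n = ∫ r in Set.Ioi (0 : ℝ), r ^ n * g r := by
  simp only [Measure.volumeIoiPow, ENNReal.ofReal]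
  rw [integral_withDensity_eq_integral_smul (by fun_prop), integral_subtype_comap measurableSet_Ioi
    fun a ↦ Real.toNNReal (a ^ n) • g a]
  refine setIntegral_congr_fun measurableSet_Ioi fun x hx => ?_
  simp [NNReal.smul_def, max_eq_left (pow_nonneg (Set.mem_Ioi.1 hx).le n)]

lemma lintegral_polar {f : E → ℝ≥0∞} (hf : Measurable f) :
    ∫⁻ x, f x ∂μ = ∫⁻ r in Set.Ioi (0 : ℝ), ENNReal.ofReal (r ^ (Module.finrank ℝ E - 1)) *
      ∫⁻ u, f (r • (u : E)) ∂μ.toSphere := by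
  rw [lintegral_polar_prod, lintegral_prod_symm' _ (by fun_prop), lintegral_volumeIoiPow
    (g := fun r => ∫⁻ u, f (r • (u : E)) ∂μ.toSphere)]
  exact Measurable.lintegral_prod_right' (f := fun p : ℝ × Metric.sphere (0 : E) 1 =>
    f (p.1 • (p.2 : E))) (by fun_prop)

lemma integrable_exp_neg_norm_sq :
    Integrable (fun x : E => Real.exp (-‖x‖ ^ 2)) μ := by
  rw [integrable_fun_norm_addHaar μ (f := fun r => Real.exp (-r ^ 2))]
  have h := integrableOn_rpow_mul_exp_neg_rpow (p := 2)
    (s := ((Module.finrank ℝ E - 1 : ℕ) : ℝ))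
    (lt_of_lt_of_le (by norm_num) (Nat.cast_nonneg _)) (by norm_num)
  refine h.congr_fun (fun x hx => ?_) measurableSet_Ioi
  simp

lemma integrable_exp_inner_sub_norm_sq (b : E) :
    Integrable (fun x : E => Real.exp (2 * inner ℝ b x - ‖x‖ ^ 2)) μ := by
  have h := ((integrable_exp_neg_norm_sq μ).comp_sub_right b).const_mul (Real.exp (‖b‖ ^ 2))
  refine h.congr (.of_forall fun x => ?_)
  simp only [← Real.exp_add]
  rw [norm_sub_sq_real, real_inner_comm]
  congr 1; ring

/-- Completing the square and translation invariance of `μ` give the exponential moments of the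
Gaussian weight. -/
lemma integral_exp_inner_sub_norm_sq (b : E) :
    ∫ x, Real.exp (2 * inner ℝ b x - ‖x‖ ^ 2) ∂μ
      = Real.exp (‖b‖ ^ 2) * ∫ x, Real.exp (-‖x‖ ^ 2) ∂μ := by
  rw [← integral_sub_right_eq_self (fun x => Real.exp (-‖x‖ ^ 2)) b, ← integral_const_mul]
  refine integral_congr_ae (.of_forall fun x => ?_)
  simp only [← Real.exp_add]
  rw [norm_sub_sq_real, real_inner_comm]
  congr 1; ring

lemma integral_pow_inner_mul_exp_neg_norm_sq (b : E) (k : ℕ) :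
    ∫ x, (2 * inner ℝ b x) ^ k * Real.exp (-‖x‖ ^ 2) ∂μ
      = (∫ u : Metric.sphere (0 : E) 1, (2 * inner ℝ b (u : E)) ^ k ∂μ.toSphere) *
        (Real.Gamma ((k + Module.finrank ℝ E : ℕ) / 2) / 2) := by
  have hd : 0 < Module.finrank ℝ E := Module.finrank_pos
  rw [integral_polar_prod]
  have h1 : ∀ p : Metric.sphere (0 : E) 1 × Set.Ioi (0 : ℝ),
      (2 * inner ℝ b (p.2.1 • (p.1 : E))) ^ k * Real.exp (-‖p.2.1 • (p.1 : E)‖ ^ 2)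
        = (2 * inner ℝ b (p.1 : E)) ^ k * ((fun r : ℝ => r ^ k * Real.exp (-r ^ 2)) p.2.1) := by
    intro p
    rw [norm_smul, norm_eq_of_mem_sphere p.1, real_inner_smul_right]
    simp only [mul_one, Real.norm_eq_abs, sq_abs]
    ring
  simp_rw [h1]
  rw [integral_prod_mul (fun u : Metric.sphere (0 : E) 1 => (2 * inner ℝ b (u : E)) ^ k)
    (fun r : Set.Ioi (0 : ℝ) => (fun r : ℝ => r ^ k * Real.exp (-r ^ 2)) r.1),
    integral_volumeIoiPow (g := fun r => r ^ k * Real.exp (-r ^ 2))]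
  congr 1
  have h := integral_rpow_mul_exp_neg_rpow (p := 2)
    (q := ((k + Module.finrank ℝ E - 1 : ℕ) : ℝ)) (by norm_num)
    (lt_of_lt_of_le (by norm_num) (Nat.cast_nonneg _))
  have e : ((k + Module.finrank ℝ E - 1 : ℕ) : ℝ) + 1 = ((k + Module.finrank ℝ E : ℕ) : ℝ) := by
    have : k + Module.finrank ℝ E = (k + Module.finrank ℝ E - 1) + 1 := by omega
    rw [this]; push_cast; simp
  rw [e] at h
  rw [div_eq_mul_inv _ (2 : ℝ), mul_comm _ (2 : ℝ)⁻¹, ← one_div, ← h]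
  refine setIntegral_congr_fun measurableSet_Ioi fun x hx => ?_
  simp only [Real.rpow_natCast, Real.rpow_two]
  rw [← mul_assoc, ← pow_add]
  congr 2; omega

/-- The generating function of the moments of a linear functional under the Gaussian weight. -/
lemma hasSum_gaussian_moments (b : E) (t : ℝ) :
    HasSum (fun k : ℕ => (∫ x, (2 * inner ℝ b x) ^ k * Real.exp (-‖x‖ ^ 2) ∂μ) /
        k.factorial * t ^ k)
      (Real.exp (t ^ 2 * ‖b‖ ^ 2) * ∫ x, Real.exp (-‖x‖ ^ 2) ∂μ) := by
  have hexp := integral_exp_inner_sub_norm_sq μ (t • b)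
  rw [norm_smul, mul_pow, Real.norm_eq_abs, sq_abs] at hexp
  rw [← hexp]
  have hterm : ∀ k : ℕ, (∫ x, (2 * inner ℝ b x) ^ k * Real.exp (-‖x‖ ^ 2) ∂μ) /
      k.factorial * t ^ k
      = ∫ x, (2 * inner ℝ (t • b) x) ^ k / k.factorial * Real.exp (-‖x‖ ^ 2) ∂μ := by
    intro k
    rw [div_mul_eq_mul_div, mul_div_assoc, mul_comm, ← integral_const_mul]
    refine integral_congr_ae (.of_forall fun x => ?_)
    simp only [real_inner_smul_left]
    ring
  simp_rw [hterm]
  set c := t • b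
  -- `exp |2⟨c,x⟩|` dominates the partial sums and is integrable against the Gaussian weight.
  have hdom : Integrable (fun x : E => Real.exp |2 * inner ℝ c x| * Real.exp (-‖x‖ ^ 2)) μ := by
    refine ((integrable_exp_inner_sub_norm_sq μ c).add
      (integrable_exp_inner_sub_norm_sq μ (-c))).mono' (by fun_prop) (.of_forall fun x => ?_)
    rw [Real.norm_eq_abs, abs_of_pos (by positivity), ← Real.exp_add]
    simp only [Pi.add_apply, inner_neg_left]
    rcases abs_cases (2 * inner ℝ c x) with ⟨h, -⟩ | ⟨h, -⟩ <;> rw [h]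
    · exact (le_add_of_nonneg_right (Real.exp_pos _).le).trans_eq' (by ring_nf)
    · exact (le_add_of_nonneg_left (Real.exp_pos _).le).trans_eq' (by ring_nf)
  have hs : ∀ y : ℝ, HasSum (fun k : ℕ => y ^ k / k.factorial) (Real.exp y) := fun y => by
    rw [Real.exp_eq_exp_ℝ]; exact NormedSpace.expSeries_div_hasSum_exp y
  refine hasSum_integral_of_dominated_convergence
    (fun k x => |2 * inner ℝ c x| ^ k / k.factorial * Real.exp (-‖x‖ ^ 2))
    (fun k => by fun_prop) (fun k => .of_forall fun x => ?_)
    (.of_forall fun x => ((hs _).mul_right _).summable) ?_ (.of_forall fun x => ?_)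
  · simp
  · simp_rw [fun x => ((hs |2 * inner ℝ c x|).mul_right (Real.exp (-‖x‖ ^ 2))).tsum_eq]
    exact hdom
  · rw [sub_eq_add_neg, Real.exp_add]
    exact (hs _).mul_right _

/-- The moments of a linear functional under the rotation invariant law of the sphere. -/
lemma integral_pow_inner_sphere {n : ℕ} (hn : 0 < n) (hE : Module.finrank ℝ E = 2 * n) (b : E) :
    (∀ j, ∫ u : Metric.sphere (0 : E) 1, (2 * inner ℝ b (u : E)) ^ (2 * j + 1) ∂μ.toSphere = 0) ∧
    ∀ j, ∫ u : Metric.sphere (0 : E) 1, (2 * inner ℝ b (u : E)) ^ (2 * j) ∂μ.toSphere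
      = μ.toSphere.real Set.univ * ((2 * j).factorial *
        (‖b‖ ^ (2 * j) * (n - 1).factorial / (j.factorial * (j + (n - 1)).factorial))) := by
  obtain ⟨n, rfl⟩ : ∃ m, n = m + 1 := ⟨n - 1, by omega⟩
  set C := ∫ x, Real.exp (-‖x‖ ^ 2) ∂μ
  have hC : C = μ.toSphere.real Set.univ * ((n.factorial : ℝ) / 2) := by
    have h := integral_pow_inner_mul_exp_neg_norm_sq μ b 0
    have e : ((0 + Module.finrank ℝ E : ℕ) : ℝ) / 2 = (n : ℝ) + 1 := by
      rw [hE]; push_cast; ring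
    rw [e, Real.Gamma_nat_eq_factorial] at h
    simpa [C] using h
  -- The power series of `t ↦ exp (t² ‖b‖²)`, written with all exponents.
  set a : ℕ → ℝ := fun k => if Even k then ‖b‖ ^ k / (k / 2).factorial * C else 0 with ha
  have h2 : ∀ t : ℝ, HasSum (fun k => a k * t ^ k) (Real.exp (t ^ 2 * ‖b‖ ^ 2) * C) := by
    intro t
    have hs : HasSum (fun k : ℕ => (t ^ 2 * ‖b‖ ^ 2) ^ k / k.factorial)
        (Real.exp (t ^ 2 * ‖b‖ ^ 2)) := by
      rw [Real.exp_eq_exp_ℝ]; exact NormedSpace.expSeries_div_hasSum_exp _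
    have hinj : Function.Injective (fun j : ℕ => 2 * j) := fun i j h => by
      simpa using h
    have hsupp : ∀ k ∉ Set.range (fun j : ℕ => 2 * j), a k * t ^ k = 0 := by
      intro k hk
      have : ¬ Even k := fun h => hk ⟨k / 2, by
        obtain ⟨m, rfl⟩ := h; dsimp only; omega⟩
      simp [ha, this]
    have hterm : (fun k => a k * t ^ k) ∘ (fun j : ℕ => 2 * j)
        = fun k : ℕ => (t ^ 2 * ‖b‖ ^ 2) ^ k / k.factorial * C := by
      ext j
      simp only [ha, Function.comp, even_two_mul, if_true]
      rw [Nat.mul_div_cancel_left j (by norm_num)]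
      ring
    rw [← hinj.hasSum_iff hsupp, hterm]
    exact hs.mul_right C
  have hcoef := coeff_eq_of_hasSum (.of_forall fun t => hasSum_gaussian_moments μ b t)
    (.of_forall h2)
  constructor
  · intro j
    have h := congrFun hcoef (2 * j + 1)
    have hodd : ¬ Even (2 * j + 1) := by simp
    simp only [ha, hodd, if_false, integral_pow_inner_mul_exp_neg_norm_sq] at h
    have hG : 0 < Real.Gamma (((2 * j + 1 + Module.finrank ℝ E : ℕ) : ℝ) / 2) :=
      Real.Gamma_pos_of_pos (by positivity)
    have hf : ((2 * j + 1).factorial : ℝ) ≠ 0 := by positivity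
    simpa [hf, hG.ne', -Nat.cast_add, -Nat.cast_mul] using h
  · intro j
    have h := congrFun hcoef (2 * j)
    have hev : Even (2 * j) := by simp
    have e : ((2 * j + Module.finrank ℝ E : ℕ) : ℝ) / 2 = ((j + n : ℕ) : ℝ) + 1 := by
      rw [hE]; push_cast; ring
    simp only [ha, hev, if_true, integral_pow_inner_mul_exp_neg_norm_sq] at h
    rw [e, Real.Gamma_nat_eq_factorial, hC] at h
    have h1 : ((2 * j).factorial : ℝ) ≠ 0 := by positivity
    have h3 : ((j + n).factorial : ℝ) ≠ 0 := by positivity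
    have h4 : (j.factorial : ℝ) ≠ 0 := by positivity
    rw [Nat.mul_div_cancel_left j (by norm_num)] at h
    field_simp at h
    simp only [Nat.add_sub_cancel]
    field_simp
    linarith

/-- The series of the spherical exponential moments; up to scaling it is the one of a modified
Bessel function, see `lintegral_exp_inner_sphere`. -/
lemma hasSum_integral_exp_inner_sphere {n : ℕ} (hn : 0 < n) (hE : Module.finrank ℝ E = 2 * n)
    (b : E) :
    HasSum (fun j : ℕ => μ.toSphere.real Set.univ *
        (‖b‖ ^ (2 * j) * (n - 1).factorial / (j.factorial * (j + (n - 1)).factorial)))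
      (∫ u : Metric.sphere (0 : E) 1, Real.exp (2 * inner ℝ b (u : E)) ∂μ.toSphere) := by
  have hs : ∀ y : ℝ, HasSum (fun k : ℕ => y ^ k / k.factorial) (Real.exp y) := fun y => by
    rw [Real.exp_eq_exp_ℝ]; exact NormedSpace.expSeries_div_hasSum_exp y
  have hall : HasSum (fun k : ℕ => ∫ u : Metric.sphere (0 : E) 1,
      (2 * inner ℝ b (u : E)) ^ k / k.factorial ∂μ.toSphere)
      (∫ u : Metric.sphere (0 : E) 1, Real.exp (2 * inner ℝ b (u : E)) ∂μ.toSphere) := by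
    refine hasSum_integral_of_dominated_convergence
      (fun k _ => (2 * ‖b‖) ^ k / k.factorial)
      (fun k => by fun_prop) (fun k => .of_forall fun x => ?_)
      (.of_forall fun x => (hs _).summable) (integrable_const _) (.of_forall fun x => hs _)
    rw [norm_div, norm_pow, RCLike.norm_natCast]
    gcongr
    rw [norm_mul]
    have := norm_inner_le_norm (𝕜 := ℝ) b (x : E)
    rw [norm_eq_of_mem_sphere x, mul_one] at this
    simpa using this
  have hinj : Function.Injective (fun j : ℕ => 2 * j) := fun i j h => by simpa using h
  rw [← hinj.hasSum_iff] at hall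
  · convert hall using 1
    ext j
    simp only [Function.comp, integral_div, (integral_pow_inner_sphere μ hn hE b).2 j]
    have h1 : ((2 * j).factorial : ℝ) ≠ 0 := by positivity
    field_simp
  · intro k hk
    have hk' : Odd k := by
      rw [← Nat.not_even_iff_odd]
      exact fun h => hk ⟨k / 2, by obtain ⟨m, rfl⟩ := h; dsimp only; omega⟩
    obtain ⟨j, rfl⟩ := hk'
    rw [integral_div, (integral_pow_inner_sphere μ hn hE b).1 j, zero_div]

end Sphere

/-! ### Complex Gaussian laws -/

lemma real_inner_eq_re {nc : ℕ} (x y : Block nc) : inner ℝ x y = (inner ℂ x y).re := by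
  simp [PiLp.inner_apply, Complex.inner, mul_comm]

lemma measurable_complex_mk : Measurable (fun p : ℝ × ℝ => (⟨p.1, p.2⟩ : ℂ)) :=
  Complex.measurableEquivRealProd.symm.measurable

instance (m : ℂ) (v : ℝ) : IsProbabilityMeasure (complexGaussian m v) :=
  Measure.isProbabilityMeasure_map measurable_complex_mk.aemeasurable

instance (nc : ℕ) : IsProbabilityMeasure (noise nc) :=
  Measure.isProbabilityMeasure_map (by fun_prop)

lemma charFun_complexGaussian (m : ℂ) {v : ℝ} (hv : 0 ≤ v) (z : ℂ) :
    charFun (complexGaussian m v) z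
      = Complex.exp ((inner ℝ m z : ℝ) * Complex.I - ((v * ‖z‖ ^ 2 / 4 : ℝ) : ℂ)) := by
  rw [complexGaussian, charFun_apply, integral_map measurable_complex_mk.aemeasurable (by fun_prop)]
  have h : ∀ p : ℝ × ℝ, Complex.exp ((inner ℝ (⟨p.1, p.2⟩ : ℂ) z : ℝ) * Complex.I)
      = Complex.exp (z.re * p.1 * Complex.I) * Complex.exp (z.im * p.2 * Complex.I) := by
    intro p
    rw [← Complex.exp_add, Complex.inner]
    simp
    ring_nf
  simp_rw [h]
  rw [integral_prod_mul (fun x : ℝ => Complex.exp (z.re * x * Complex.I))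
    (fun x : ℝ => Complex.exp (z.im * x * Complex.I)), ← charFun_apply_real,
    ← charFun_apply_real, charFun_gaussianReal, charFun_gaussianReal, ← Complex.exp_add,
    Complex.inner, Complex.sq_norm, Complex.normSq_apply]
  congr 1
  have hv2 : (((v / 2).toNNReal : ℝ) : ℂ) = ((v / 2 : ℝ) : ℂ) := by
    rw [Real.coe_toNNReal _ (by positivity)]
  rw [hv2]
  simp
  ring

lemma charFun_noise {nc : ℕ} (t : Block nc) :
    charFun (noise nc) t = Complex.exp (-((‖t‖ ^ 2 / 4 : ℝ) : ℂ)) := by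
  rw [noise, charFun_pi]
  simp_rw [charFun_complexGaussian 0 zero_le_one]
  rw [← Complex.exp_sum, EuclideanSpace.norm_sq_eq]
  congr 1
  simp [Finset.sum_div]

/-- The noise has a Gaussian density, so it charges no Lebesgue null set. -/
lemma noise_absolutelyContinuous (nc : ℕ) : noise nc ≪ (volume : Measure (Block nc)) := by
  have hfin : Module.finrank ℝ (Block nc) = 2 * nc := by
    rw [← Module.finrank_mul_finrank ℝ ℂ (Block nc)]; simp
  set c : ℝ := Real.pi ^ nc
  have hc : 0 < c := by positivity
  have hint : Integrable (fun x : Block nc => Real.exp (-(1 : ℝ) * ‖x‖ ^ 2)) volume := by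
    have h := (GaussianFourier.integrable_cexp_neg_mul_sq_norm_add (V := Block nc) (b := 1)
      (by simp) 0 0).norm
    refine h.congr (.of_forall fun x => ?_)
    simp [Complex.norm_exp, ← Complex.ofReal_pow]
  have hone : ∫ x : Block nc, c⁻¹ * Real.exp (-(1 : ℝ) * ‖x‖ ^ 2) = 1 := by
    rw [integral_const_mul, GaussianFourier.integral_rexp_neg_mul_sq_norm one_pos, hfin]
    simp only [div_one]
    rw [show ((2 * nc : ℕ) : ℝ) / 2 = nc by push_cast; ring, Real.rpow_natCast]
    exact inv_mul_cancel₀ hc.ne'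
  set γ : Measure (Block nc) := volume.withDensity
    (fun x => ENNReal.ofReal (c⁻¹ * Real.exp (-(1 : ℝ) * ‖x‖ ^ 2))) with hγ
  have : IsProbabilityMeasure γ := by
    refine ⟨?_⟩
    rw [hγ, withDensity_apply _ MeasurableSet.univ, Measure.restrict_univ,
      ← ofReal_integral_eq_lintegral_ofReal (hint.const_mul _)
        (.of_forall fun x => by positivity), hone]
    simp
  have hnoise : noise nc = γ := by
    refine Measure.ext_of_charFun (funext fun t => ?_)
    rw [charFun_noise, charFun_apply, hγ, integral_withDensity_eq_integral_toReal_smul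
      (by fun_prop) (.of_forall fun x => by simp)]
    have h := GaussianFourier.integral_cexp_neg_mul_sq_norm_add (V := Block nc) (b := 1)
      (by simp) Complex.I t
    have hterm : ∀ x : Block nc, (ENNReal.ofReal (c⁻¹ * Real.exp (-(1 : ℝ) * ‖x‖ ^ 2))).toReal •
        Complex.exp ((inner ℝ x t : ℝ) * Complex.I)
        = (c⁻¹ : ℂ) * Complex.exp (-1 * (‖x‖ : ℂ) ^ 2 + Complex.I * (inner ℝ t x : ℝ)) := by
      intro x
      rw [ENNReal.toReal_ofReal (by positivity), Complex.real_smul, real_inner_comm]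
      push_cast
      rw [mul_assoc, ← Complex.exp_add]
      ring_nf
    simp_rw [hterm]
    rw [integral_const_mul, h, hfin]
    simp only [div_one]
    rw [show (((2 * nc : ℕ) : ℂ) / 2) = (nc : ℂ) by push_cast; ring, Complex.cpow_natCast,
      ← mul_assoc]
    have : (c⁻¹ : ℂ) * (Real.pi : ℂ) ^ nc = 1 := by
      simp only [c]; push_cast
      exact inv_mul_cancel₀ (pow_ne_zero _ (by exact_mod_cast Real.pi_ne_zero))
    rw [this, one_mul]
    congr 1
    push_cast
    rw [Complex.I_sq]; ring
  rw [hnoise]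
  exact withDensity_absolutelyContinuous _ _

/-! ### The law of one block of the channel output -/

/-- The law of the output `H x + W` of one block for the input `x`. -/
noncomputable def blockLaw (κ : ℝ) {nc : ℕ} (x : Block nc) : Measure (Block nc) :=
  ((complexGaussian (muH κ : ℂ) (sigmaH2 κ)).prod (noise nc)).map
    (fun hw : ℂ × Block nc => hw.1 • x + hw.2)

instance (κ : ℝ) {nc : ℕ} (x : Block nc) : IsProbabilityMeasure (blockLaw κ x) :=
  Measure.isProbabilityMeasure_map (by fun_prop)

lemma sigmaH2_pos {κ : ℝ} (hκ : 0 ≤ κ) : 0 < sigmaH2 κ := inv_pos.2 (by linarith)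

lemma charFun_blockLaw {κ : ℝ} (hκ : 0 ≤ κ) {nc : ℕ} (x t : Block nc) :
    charFun (blockLaw κ x) t = Complex.exp (((muH κ * (inner ℂ x t).re : ℝ) : ℂ) * Complex.I
      - (((sigmaH2 κ * ‖inner ℂ x t‖ ^ 2 + ‖t‖ ^ 2) / 4 : ℝ) : ℂ)) := by
  have hmap : blockLaw κ x = (((complexGaussian (muH κ : ℂ) (sigmaH2 κ)).map
      (fun h : ℂ => h • x)).prod (noise nc)).map (fun p => p.1 + p.2) := by
    rw [blockLaw]
    conv_rhs => rw [← Measure.map_id (μ := noise nc)]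
    rw [Measure.map_prod_map _ _ (by fun_prop) measurable_id,
      Measure.map_map (by fun_prop) (by fun_prop)]
    rfl
  have : IsProbabilityMeasure ((complexGaussian (muH κ : ℂ) (sigmaH2 κ)).map
      (fun h : ℂ => h • x)) := Measure.isProbabilityMeasure_map (by fun_prop)
  rw [hmap, charFun_map_add_prod_eq_mul, Pi.mul_apply, charFun_noise, charFun_apply,
    integral_map (by fun_prop) (by fun_prop)]
  have h : ∀ h : ℂ, inner ℝ (h • x) t = inner ℝ h (inner ℂ x t) := by
    intro h
    rw [real_inner_eq_re, inner_smul_left, Complex.inner, mul_comm]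
  simp_rw [h]
  rw [← charFun_apply, charFun_complexGaussian _ (sigmaH2_pos hκ).le, ← Complex.exp_add,
    Complex.inner]
  congr 1
  simp
  ring

lemma exists_unitary_map_single {nc : ℕ} (hnc : 0 < nc) {u : Block nc} (hu : ‖u‖ = 1) :
    ∃ U : Block nc ≃ₗᵢ[ℂ] Block nc, U (EuclideanSpace.single ⟨0, hnc⟩ 1) = u := by
  obtain ⟨b, hb⟩ := Orthonormal.exists_orthonormalBasis_extension_of_card_eq (𝕜 := ℂ)
    (E := Block nc) (ι := Fin nc) (by simp) (v := fun _ => u) (s := {⟨0, hnc⟩}) (by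
      refine ⟨fun i => hu, fun i j hij => ?_⟩
      exact absurd (Subsingleton.elim i j) hij)
  exact ⟨b.repr.symm, by rw [← hb ⟨0, hnc⟩ rfl, b.repr_symm_single]⟩

lemma continuous_wTilde (κ ρ : ℝ) (nc : ℕ) : Continuous (wTilde κ ρ (nc := nc)) := by
  unfold wTilde
  refine (PiLp.continuous_toLp 2 _).comp (continuous_pi fun i => ?_)
  split_ifs <;> fun_prop

/-- A unitary map that sends the first coordinate axis to the direction of the input sends the
law of `wTilde` to the law of the output. -/
lemma blockLaw_eq_map_wTilde {κ ρ : ℝ} (hκ : 0 ≤ κ) (hρ : 0 < ρ) {nc : ℕ} (hnc : 0 < nc)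
    (U : Block nc ≃ₗᵢ[ℂ] Block nc) :
    blockLaw κ ((Real.sqrt (nc * ρ) : ℂ) • U (EuclideanSpace.single ⟨0, hnc⟩ 1))
      = (noise nc).map (fun w => U (wTilde κ ρ w)) := by
  have hm : Measurable (fun w : Block nc => U (wTilde κ ρ w)) :=
    (U.continuous.comp (continuous_wTilde κ ρ nc)).measurable
  have : IsProbabilityMeasure ((noise nc).map (fun w => U (wTilde κ ρ w))) :=
    Measure.isProbabilityMeasure_map hm.aemeasurable
  refine Measure.ext_of_charFun (funext fun t => ?_)
  obtain ⟨t, rfl⟩ := U.surjective t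
  rw [charFun_blockLaw hκ, charFun_apply, integral_map hm.aemeasurable (by fun_prop)]
  set P : ℝ := nc * ρ
  have hP : 0 ≤ P := by positivity
  set i₀ : Fin nc := ⟨0, hnc⟩
  set d : ℝ := Real.sqrt (sigmaH2 κ * nc * ρ + 1)
  have hd : d ^ 2 = sigmaH2 κ * P + 1 := by
    have := (sigmaH2_pos hκ).le
    rw [Real.sq_sqrt (by positivity)]; ring
  have hinner : ∀ w : Block nc, inner ℝ (U (wTilde κ ρ w)) (U t)
      = muH κ * Real.sqrt P * (t i₀).re
        + inner ℝ w (WithLp.toLp 2 (fun i => if i = i₀ then (d : ℂ) * t i else t i)) := by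
    intro w
    rw [real_inner_eq_re, U.inner_map_map, real_inner_eq_re, PiLp.inner_apply, PiLp.inner_apply,
      Complex.re_sum, Complex.re_sum, ← Finset.add_sum_erase _ _ (Finset.mem_univ i₀),
      ← Finset.add_sum_erase _ _ (Finset.mem_univ i₀), ← add_assoc]
    congr 1
    · simp [wTilde, i₀, P, d]
      ring
    · refine Finset.sum_congr rfl fun i hi => ?_
      have h1 : i ≠ i₀ := Finset.ne_of_mem_erase hi
      have h2 : i.val ≠ 0 := fun h => h1 (Fin.ext h)
      simp [wTilde, h1, h2]
  have hnorm : ‖(WithLp.toLp 2 (fun i => if i = i₀ then (d : ℂ) * t i else t i) : Block nc)‖ ^ 2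
      = ‖t‖ ^ 2 + sigmaH2 κ * P * ‖t i₀‖ ^ 2 := by
    rw [EuclideanSpace.norm_sq_eq, EuclideanSpace.norm_sq_eq,
      ← Finset.add_sum_erase _ _ (Finset.mem_univ i₀),
      ← Finset.add_sum_erase _ (fun i => ‖t i‖ ^ 2) (Finset.mem_univ i₀)]
    have : ∀ i ∈ Finset.univ.erase i₀,
        ‖(WithLp.toLp 2 (fun i => if i = i₀ then (d : ℂ) * t i else t i) : Block nc) i‖ ^ 2
          = ‖t i‖ ^ 2 := fun i hi => by
      simp [Finset.ne_of_mem_erase hi]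
    rw [Finset.sum_congr rfl this]
    simp only [if_true, norm_mul, mul_pow, Complex.norm_real, Real.norm_eq_abs, sq_abs, hd]
    ring
  simp_rw [hinner, Complex.ofReal_add, add_mul, Complex.exp_add]
  rw [integral_const_mul, ← charFun_apply, charFun_noise, hnorm, ← Complex.exp_add]
  have hx : inner ℂ ((Real.sqrt P : ℂ) • U (EuclideanSpace.single i₀ 1)) (U t)
      = (Real.sqrt P : ℂ) * t i₀ := by
    rw [inner_smul_left, U.inner_map_map, EuclideanSpace.inner_single_left]
    simp
  rw [hx, U.norm_map, norm_mul, mul_pow, Complex.norm_real, Real.norm_eq_abs, sq_abs,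
    Real.sq_sqrt hP, Complex.re_ofReal_mul]
  congr 1
  push_cast
  ring

lemma blockLaw_absolutelyContinuous (κ : ℝ) {nc : ℕ} (x : Block nc) :
    blockLaw κ x ≪ (volume : Measure (Block nc)) := by
  refine Measure.AbsolutelyContinuous.mk fun s hs h0 => ?_
  have hm : Measurable (fun hw : ℂ × Block nc => hw.1 • x + hw.2) := by fun_prop
  rw [blockLaw, Measure.map_apply hm hs, Measure.prod_apply (hm hs)]
  refine (lintegral_congr fun h => ?_).trans lintegral_zero
  refine noise_absolutelyContinuous nc ?_
  rw [← h0]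
  exact measure_preimage_add volume (h • x) s

lemma ae_wTilde_ne_zero {κ ρ : ℝ} (hκ : 0 ≤ κ) (hρ : 0 < ρ) {nc : ℕ} (hnc : 0 < nc) :
    ∀ᵐ w ∂noise nc, wTilde κ ρ w ≠ 0 := by
  have hne : Nonempty (Fin nc) := ⟨⟨0, hnc⟩⟩
  have h := blockLaw_eq_map_wTilde hκ hρ hnc (LinearIsometryEquiv.refl ℂ (Block nc))
  have h0 : ∀ᵐ y ∂(noise nc).map (fun w => wTilde κ ρ w), y ≠ 0 := by
    have : (noise nc).map (fun w => wTilde κ ρ w) ≪ (volume : Measure (Block nc)) := by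
      have := blockLaw_absolutelyContinuous κ
        ((Real.sqrt (nc * ρ) : ℂ) • (EuclideanSpace.single ⟨0, hnc⟩ 1 : Block nc))
      exact h ▸ this
    refine this.ae_le ?_
    exact (measure_singleton (0 : Block nc) : volume {(0 : Block nc)} = 0) |> compl_mem_ae_iff.2
  exact ae_of_ae_map (continuous_wTilde κ ρ nc).measurable.aemeasurable h0

/-! ### Bessel functions as exponential moments -/

lemma summable_besselI (n : ℕ) (x : ℝ) :
    Summable (fun j : ℕ => (x / 2) ^ (2 * j + n) / ((j.factorial : ℝ) * ((j + n).factorial : ℝ))) := by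
  have h := (Real.summable_pow_div_factorial ((x / 2) ^ 2)).mul_left (|x / 2| ^ n)
  refine Summable.of_norm_bounded h fun j => ?_
  have hpos : (0 : ℝ) < (j.factorial : ℝ) * ((j + n).factorial : ℝ) := by positivity
  rw [norm_div, norm_pow, Real.norm_eq_abs, Real.norm_eq_abs, abs_of_pos hpos,
    pow_add, pow_mul, sq_abs, mul_comm (((x / 2) ^ 2) ^ j), mul_div_assoc]
  gcongr
  have : (1 : ℝ) ≤ ((j + n).factorial : ℝ) := by exact_mod_cast Nat.factorial_pos _
  exact le_mul_of_one_le_right (by positivity) this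

lemma measurable_besselI (n : ℕ) : Measurable (besselI n) := by
  refine measurable_of_tendsto_metrizable (f := fun (N : ℕ) (x : ℝ) => ∑ j ∈ Finset.range N,
    (x / 2) ^ (2 * j + n) / ((j.factorial : ℝ) * ((j + n).factorial : ℝ)))
    (fun N => by fun_prop) ?_
  rw [tendsto_pi_nhds]
  exact fun x => (summable_besselI n x).hasSum.tendsto_sum_nat

lemma besselI_nonneg (n : ℕ) {x : ℝ} (hx : 0 ≤ x) : 0 ≤ besselI n x :=
  tsum_nonneg fun j => by positivity

section Sphere

set_option linter.unusedSectionVars false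

variable {E : Type*} [NormedAddCommGroup E] [InnerProductSpace ℝ E] [FiniteDimensional ℝ E]
  [MeasurableSpace E] [BorelSpace E] [Nontrivial E] (μ : Measure E) [μ.IsAddHaarMeasure]

lemma integral_exp_inner_sphere {m : ℕ} (hE : Module.finrank ℝ E = 2 * (m + 1)) (b : E) :
    ‖b‖ ^ m * ∫ u : Metric.sphere (0 : E) 1, Real.exp (2 * inner ℝ b (u : E)) ∂μ.toSphere
      = μ.toSphere.real Set.univ * (m.factorial * besselI m (2 * ‖b‖)) := by
  have h := (hasSum_integral_exp_inner_sphere μ (Nat.succ_pos m) hE b).mul_left (‖b‖ ^ m)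
  rw [← h.tsum_eq, besselI, ← tsum_mul_left, ← tsum_mul_left]
  refine tsum_congr fun j => ?_
  rw [mul_div_cancel_left₀ _ (two_ne_zero), pow_add]
  simp only [Nat.succ_eq_add_one, Nat.add_sub_cancel]
  ring

lemma lintegral_exp_inner_sphere {m : ℕ} (hE : Module.finrank ℝ E = 2 * (m + 1)) {b : E}
    (hb : ‖b‖ ^ m ≠ 0) :
    ∫⁻ u : Metric.sphere (0 : E) 1, ENNReal.ofReal (Real.exp (2 * inner ℝ b (u : E))) ∂μ.toSphere
      = μ.toSphere Set.univ *
        ENNReal.ofReal (m.factorial * besselI m (2 * ‖b‖) / ‖b‖ ^ m) := by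
  have hint : Integrable (fun u : Metric.sphere (0 : E) 1 => Real.exp (2 * inner ℝ b (u : E)))
      μ.toSphere := by
    refine Integrable.of_bound (by fun_prop) (Real.exp (2 * ‖b‖)) (.of_forall fun u => ?_)
    rw [Real.norm_eq_abs, Real.abs_exp]
    have := real_inner_le_norm b (u : E)
    rw [norm_eq_of_mem_sphere u, mul_one] at this
    gcongr
  rw [← ofReal_integral_eq_lintegral_ofReal hint (.of_forall fun u => (Real.exp_pos _).le),
    ← ofReal_measureReal (measure_ne_top _ _), ← ENNReal.ofReal_mul measureReal_nonneg]
  congr 1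
  rw [← mul_div_assoc, ← integral_exp_inner_sphere μ hE b]
  field_simp

end Sphere

lemma setLIntegral_Ioi_comp_sq {F : ℝ → ℝ≥0∞} :
    ∫⁻ r in Set.Ioi (0 : ℝ), ENNReal.ofReal (2 * r) * F (r ^ 2) = ∫⁻ z in Set.Ioi (0 : ℝ), F z := by
  have himg : (fun r : ℝ => r ^ 2) '' Set.Ioi 0 = Set.Ioi 0 := by
    ext z
    constructor
    · rintro ⟨r, hr, rfl⟩; exact pow_pos (Set.mem_Ioi.1 hr) 2
    · intro hz; exact ⟨Real.sqrt z, Real.sqrt_pos.2 hz, Real.sq_sqrt (le_of_lt hz)⟩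
  conv_rhs => rw [← himg]
  rw [lintegral_image_eq_lintegral_abs_deriv_mul (f' := fun r => 2 * r) measurableSet_Ioi
    (fun r _ => by simpa using (hasDerivAt_pow 2 r).hasDerivWithinAt)
    (fun a ha b hb h => (pow_left_inj₀ (Set.mem_Ioi.1 ha).le (Set.mem_Ioi.1 hb).le two_ne_zero).1 h)]
  refine setLIntegral_congr_fun measurableSet_Ioi fun r hr => ?_
  rw [abs_of_pos (mul_pos two_pos (Set.mem_Ioi.1 hr))]

/-- Integration over the phase of a complex variable. -/
lemma lintegral_complex_norm_mul_exp {G : ℝ → ℝ≥0∞} (hG : Measurable G) (b : ℂ) :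
    ∫⁻ h : ℂ, G ‖h‖ * ENNReal.ofReal (Real.exp (2 * inner ℝ b h))
      = ENNReal.ofReal Real.pi * ∫⁻ z in Set.Ioi (0 : ℝ),
        G (Real.sqrt z) * ENNReal.ofReal (besselI 0 (2 * (Real.sqrt z * ‖b‖))) := by
  have hfin : Module.finrank ℝ ℂ = 2 * (0 + 1) := by simp
  have huniv : (volume : Measure ℂ).toSphere Set.univ = ENNReal.ofReal (2 * Real.pi) := by
    rw [Measure.toSphere_apply_univ, Complex.volume_ball, Complex.finrank_real_complex]
    rw [ENNReal.ofReal_mul (by norm_num)]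
    rw [← NNReal.coe_real_pi, ENNReal.ofReal_coe_nnreal]
    simp
  rw [lintegral_polar volume (by fun_prop), ← setLIntegral_Ioi_comp_sq
      (F := fun z => G (Real.sqrt z) * ENNReal.ofReal (besselI 0 (2 * (Real.sqrt z * ‖b‖)))),
    ← lintegral_const_mul' _ _ ENNReal.ofReal_ne_top]
  refine setLIntegral_congr_fun measurableSet_Ioi fun r hr => ?_
  have hr0 : 0 < r := hr
  have h1 : ∀ u : Metric.sphere (0 : ℂ) 1, G ‖r • (u : ℂ)‖ *
      ENNReal.ofReal (Real.exp (2 * inner ℝ b (r • (u : ℂ))))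
      = G r * ENNReal.ofReal (Real.exp (2 * inner ℝ (r • b) (u : ℂ))) := by
    intro u
    rw [norm_smul, norm_eq_of_mem_sphere u, real_inner_smul_left, real_inner_smul_right,
      Real.norm_of_nonneg hr0.le, mul_one]
  rw [lintegral_congr h1]
  rw [lintegral_const_mul _ (by fun_prop), lintegral_exp_inner_sphere volume hfin (by simp), huniv,
    Real.sqrt_sq hr0.le, norm_smul, Real.norm_of_nonneg hr0.le, Complex.finrank_real_complex]
  simp only [pow_zero, Nat.factorial_zero, Nat.cast_one, one_mul, div_one]
  rw [ENNReal.ofReal_mul (p := 2) (by norm_num), ENNReal.ofReal_mul (p := 2) (by norm_num)]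
  rw [show (2 - 1 : ℕ) = 1 from rfl, pow_one]
  ring

/-! ### The averaged likelihood -/

/-- The uniform law on the unit sphere of `ℂ^nc`. -/
noncomputable def sphereUniform (nc : ℕ) : Measure (Metric.sphere (0 : Block nc) 1) :=
  ((volume : Measure (Block nc)).toSphere Set.univ)⁻¹ • (volume : Measure (Block nc)).toSphere

lemma isProbabilityMeasure_sphereUniform {nc : ℕ} (hnc : 0 < nc) :
    IsProbabilityMeasure (sphereUniform nc) := by
  have hne : Nonempty (Fin nc) := ⟨⟨0, hnc⟩⟩
  refine ⟨?_⟩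
  rw [sphereUniform, Measure.smul_apply, smul_eq_mul, ENNReal.inv_mul_cancel]
  · exact fun h => Measure.toSphere_ne_zero (volume : Measure (Block nc))
      (Measure.measure_univ_eq_zero.1 h)
  · exact measure_ne_top _ _

/-- The point of the sphere of squared radius `nc * ρ` in the direction `u`. -/
noncomputable def codeword (ρ : ℝ) {nc : ℕ} (u : Metric.sphere (0 : Block nc) 1) : Block nc :=
  (Real.sqrt (nc * ρ) : ℂ) • (u : Block nc)

lemma continuous_codeword (ρ : ℝ) (nc : ℕ) : Continuous (codeword ρ (nc := nc)) := by
  unfold codeword; fun_prop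

lemma norm_codeword_sq {ρ : ℝ} (hρ : 0 < ρ) {nc : ℕ} (u : Metric.sphere (0 : Block nc) 1) :
    ‖codeword ρ u‖ ^ 2 = nc * ρ := by
  rw [codeword, norm_smul, norm_eq_of_mem_sphere u, Complex.norm_real, mul_one, Real.norm_eq_abs,
    sq_abs, Real.sq_sqrt (by positivity)]

/-- Minus the logarithm of the density of the output `y` given the input `x`, up to a constant that
depends only on `‖x‖`: the output is Gaussian with mean `μ x` and covariance `1 + σ² x xᴴ`. -/
noncomputable def misfit (κ : ℝ) {nc : ℕ} (x y : Block nc) : ℝ :=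
  ‖y - (muH κ : ℂ) • x‖ ^ 2
    - sigmaH2 κ * ‖inner ℂ x (y - (muH κ : ℂ) • x)‖ ^ 2 / (1 + sigmaH2 κ * ‖x‖ ^ 2)

lemma misfit_nonneg {κ : ℝ} (hκ : 0 ≤ κ) {nc : ℕ} (x y : Block nc) : 0 ≤ misfit κ x y := by
  have hσ := sigmaH2_pos hκ
  set v := y - (muH κ : ℂ) • x
  have h := norm_inner_le_norm (𝕜 := ℂ) x v
  have h2 : ‖inner ℂ x v‖ ^ 2 ≤ ‖x‖ ^ 2 * ‖v‖ ^ 2 := by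
    rw [← mul_pow]; gcongr
  rw [misfit, sub_nonneg, div_le_iff₀ (by positivity)]
  nlinarith [mul_le_mul_of_nonneg_left h2 hσ.le, sq_nonneg ‖v‖]

lemma continuous_misfit (κ : ℝ) (hκ : 0 ≤ κ) (nc : ℕ) :
    Continuous (fun p : Block nc × Block nc => misfit κ p.1 p.2) := by
  have hσ := sigmaH2_pos hκ
  unfold misfit
  refine Continuous.sub (by fun_prop) (Continuous.div (by fun_prop) (by fun_prop) fun p => ?_)
  positivity

lemma misfit_unitary (κ : ℝ) {nc : ℕ} (U : Block nc ≃ₗᵢ[ℂ] Block nc) (x y : Block nc) :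
    misfit κ (U x) (U y) = misfit κ x y := by
  simp only [misfit, ← map_smul, ← map_sub, U.norm_map, U.inner_map_map]

lemma misfit_wTilde {κ ρ : ℝ} (hκ : 0 ≤ κ) (hρ : 0 < ρ) {nc : ℕ} (hnc : 0 < nc) (w : Block nc) :
    misfit κ ((Real.sqrt (nc * ρ) : ℂ) • EuclideanSpace.single ⟨0, hnc⟩ 1) (wTilde κ ρ w)
      = ‖w‖ ^ 2 := by
  have hσ := sigmaH2_pos hκ
  set P : ℝ := nc * ρ with hPdef
  have hP : 0 ≤ P := by positivity
  set i₀ : Fin nc := ⟨0, hnc⟩ with hi₀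
  set d : ℝ := Real.sqrt (sigmaH2 κ * nc * ρ + 1) with hddef
  have hd : d ^ 2 = sigmaH2 κ * P + 1 := by
    rw [hddef, Real.sq_sqrt (by positivity)]; ring
  set x : Block nc := (Real.sqrt P : ℂ) • EuclideanSpace.single i₀ 1 with hx
  have hv : wTilde κ ρ w - (muH κ : ℂ) • x
      = WithLp.toLp 2 (fun i => if i = i₀ then (d : ℂ) * w i else w i) := by
    ext i
    by_cases h : i = i₀
    · subst h
      simp [wTilde, hx, hi₀, d, hPdef]
    · have h2 : i.val ≠ 0 := fun h' => h (Fin.ext h')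
      simp [wTilde, hx, h, h2]
  have hnorm : ‖(WithLp.toLp 2 (fun i => if i = i₀ then (d : ℂ) * w i else w i) : Block nc)‖ ^ 2
      = ‖w‖ ^ 2 + sigmaH2 κ * P * ‖w i₀‖ ^ 2 := by
    rw [EuclideanSpace.norm_sq_eq, EuclideanSpace.norm_sq_eq,
      ← Finset.add_sum_erase _ _ (Finset.mem_univ i₀),
      ← Finset.add_sum_erase _ (fun i => ‖w i‖ ^ 2) (Finset.mem_univ i₀)]
    have : ∀ i ∈ Finset.univ.erase i₀,
        ‖(WithLp.toLp 2 (fun i => if i = i₀ then (d : ℂ) * w i else w i) : Block nc) i‖ ^ 2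
          = ‖w i‖ ^ 2 := fun i hi => by
      simp [Finset.ne_of_mem_erase hi]
    rw [Finset.sum_congr rfl this]
    simp only [if_true, norm_mul, mul_pow, Complex.norm_real, Real.norm_eq_abs, sq_abs, hd]
    ring
  have hxn : ‖x‖ ^ 2 = P := by
    rw [hx, norm_smul, mul_pow, Complex.norm_real, Real.norm_eq_abs, sq_abs, Real.sq_sqrt hP]
    simp
  rw [misfit, hv, hnorm, hxn, hx, inner_smul_left, EuclideanSpace.inner_single_left]
  simp only [if_true, map_one, one_mul, norm_mul, mul_pow, Complex.norm_real, Real.norm_eq_abs,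
    sq_abs, hd, Complex.conj_ofReal, Real.sq_sqrt hP]
  have : 1 + sigmaH2 κ * P ≠ 0 := by positivity
  field_simp
  ring

/-- Gaussian mixture representation of the likelihood: integrate over the fading coefficient. -/
lemma lintegral_exp_fading {κ s : ℝ} (hκ : 0 ≤ κ) (hs : 0 < s) {nc : ℕ} (x y : Block nc) :
    ∫⁻ h : ℂ, ENNReal.ofReal (Real.exp (-s * (‖h - (muH κ : ℂ)‖ ^ 2 / sigmaH2 κ + ‖y - h • x‖ ^ 2)))
      = ENNReal.ofReal (Real.pi / (s * ((sigmaH2 κ)⁻¹ + ‖x‖ ^ 2))) *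
        ENNReal.ofReal (Real.exp (-s * misfit κ x y)) := by
  have hσ := sigmaH2_pos hκ
  set v := y - (muH κ : ℂ) • x with hv
  set A : ℝ := (sigmaH2 κ)⁻¹ + ‖x‖ ^ 2 with hA
  have hA0 : 0 < A := by positivity
  have hid : ∀ h : ℂ, ‖h - (muH κ : ℂ)‖ ^ 2 / sigmaH2 κ + ‖y - h • x‖ ^ 2
      = A * ‖h - ((muH κ : ℂ) + inner ℂ x v / A)‖ ^ 2 + misfit κ x y := by
    intro h
    set g := h - (muH κ : ℂ) with hg
    have e1 : y - h • x = v - g • x := by rw [hv, hg, sub_smul]; abel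
    have e2 : h - ((muH κ : ℂ) + inner ℂ x v / A) = g - inner ℂ x v / A := by rw [hg]; ring
    have n1 : ‖v - g • x‖ ^ 2 = ‖v‖ ^ 2 - 2 * (inner ℂ x v * (starRingEnd ℂ) g).re
        + ‖g‖ ^ 2 * ‖x‖ ^ 2 := by
      rw [@norm_sub_sq ℂ, norm_smul, mul_pow, inner_smul_right, ← inner_conj_symm v x]
      generalize inner ℂ x v = z
      simp
      ring
    have n2 : ‖g - inner ℂ x v / A‖ ^ 2 = ‖g‖ ^ 2 - 2 * (inner ℂ x v * (starRingEnd ℂ) g).re / A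
        + ‖inner ℂ x v‖ ^ 2 / A ^ 2 := by
      rw [Complex.sq_norm, Complex.sq_norm, Complex.sq_norm, Complex.normSq_sub,
        Complex.normSq_div, Complex.normSq_ofReal, map_div₀, Complex.conj_ofReal,
        ← mul_div_assoc, Complex.div_ofReal_re, ← Complex.conj_re, map_mul, Complex.conj_conj,
        mul_comm ((starRingEnd ℂ) g)]
      ring
    have hm : misfit κ x y = ‖v‖ ^ 2 - ‖inner ℂ x v‖ ^ 2 / A := by
      rw [misfit, ← hv, hA]
      have : 1 + sigmaH2 κ * ‖x‖ ^ 2 ≠ 0 := by positivity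
      have : (sigmaH2 κ)⁻¹ + ‖x‖ ^ 2 ≠ 0 := by positivity
      field_simp
    rw [e1, e2, n1, n2, hm]
    have hA' : ‖g‖ ^ 2 / sigmaH2 κ = ‖g‖ ^ 2 * (A - ‖x‖ ^ 2) := by rw [hA]; field_simp; ring
    rw [hA']
    field_simp
    ring
  have hG : ∫⁻ h : ℂ, ENNReal.ofReal (Real.exp (-(s * A) * ‖h‖ ^ 2))
      = ENNReal.ofReal (Real.pi / (s * A)) := by
    have hb : 0 < s * A := by positivity
    have hval := GaussianFourier.integral_rexp_neg_mul_sq_norm (V := ℂ) hb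
    rw [Complex.finrank_real_complex] at hval
    simp only [Nat.cast_ofNat, div_self (two_ne_zero (α := ℝ)), Real.rpow_one] at hval
    have hint : Integrable (fun h : ℂ => Real.exp (-(s * A) * ‖h‖ ^ 2)) := by
      refine .of_integral_ne_zero ?_
      rw [hval]; positivity
    rw [← ofReal_integral_eq_lintegral_ofReal hint (.of_forall fun u => (Real.exp_pos _).le), hval]
  simp_rw [hid]
  rw [← hG, ← lintegral_sub_right_eq_self (fun h : ℂ => ENNReal.ofReal
      (Real.exp (-(s * A) * ‖h‖ ^ 2))) ((muH κ : ℂ) + inner ℂ x v / A),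
    ← lintegral_mul_const' _ _ ENNReal.ofReal_ne_top]
  refine lintegral_congr fun h => ?_
  rw [← ENNReal.ofReal_mul (Real.exp_pos _).le, ← Real.exp_add]
  ring_nf

/-- The average of the `s`-th power of the likelihood of `y` over uniformly distributed inputs. -/
noncomputable def averageLikelihood (κ ρ s : ℝ) {nc : ℕ} (y : Block nc) : ℝ≥0∞ :=
  ∫⁻ u, ENNReal.ofReal (Real.exp (-s * misfit κ (codeword ρ u) y)) ∂sphereUniform nc

lemma measurable_misfit_codeword {κ : ℝ} (hκ : 0 ≤ κ) (ρ : ℝ) (nc : ℕ) :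
    Measurable (fun p : Metric.sphere (0 : Block nc) 1 × Block nc =>
      misfit κ (codeword ρ p.1) p.2) :=
  ((continuous_misfit κ hκ nc).comp
    (((continuous_codeword ρ nc).comp continuous_fst).prodMk continuous_snd)).measurable

lemma measurable_averageLikelihood {κ : ℝ} (hκ : 0 ≤ κ) (ρ s : ℝ) {nc : ℕ} (hnc : 0 < nc) :
    Measurable (averageLikelihood κ ρ s (nc := nc)) := by
  have := isProbabilityMeasure_sphereUniform hnc
  refine Measurable.lintegral_prod_left' (f := fun p : Metric.sphere (0 : Block nc) 1 × Block nc =>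
    ENNReal.ofReal (Real.exp (-s * misfit κ (codeword ρ p.1) p.2))) ?_
  have := measurable_misfit_codeword hκ ρ nc
  fun_prop

lemma averageLikelihood_zero (κ ρ : ℝ) {nc : ℕ} (hnc : 0 < nc) (y : Block nc) :
    averageLikelihood κ ρ 0 y = 1 := by
  have := isProbabilityMeasure_sphereUniform hnc
  simp [averageLikelihood]

lemma averageLikelihood_le_one {κ : ℝ} (hκ : 0 ≤ κ) (ρ : ℝ) {s : ℝ} (hs : 0 ≤ s) {nc : ℕ}
    (hnc : 0 < nc) (y : Block nc) : averageLikelihood κ ρ s y ≤ 1 := by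
  have := isProbabilityMeasure_sphereUniform hnc
  calc averageLikelihood κ ρ s y ≤ ∫⁻ _, 1 ∂sphereUniform nc := by
        refine lintegral_mono fun u => ?_
        rw [ENNReal.ofReal_le_one, Real.exp_le_one_iff]
        have := mul_nonneg hs (misfit_nonneg hκ (codeword ρ u) y)
        linarith
    _ = 1 := by simp

lemma averageLikelihood_ne_zero {κ : ℝ} (hκ : 0 ≤ κ) (ρ s : ℝ) {nc : ℕ} (hnc : 0 < nc)
    (y : Block nc) : averageLikelihood κ ρ s y ≠ 0 := by
  have := isProbabilityMeasure_sphereUniform hnc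
  have hm : Measurable (fun u : Metric.sphere (0 : Block nc) 1 =>
      ENNReal.ofReal (Real.exp (-s * misfit κ (codeword ρ u) y))) := by
    have := (measurable_misfit_codeword hκ ρ nc).comp (measurable_prodMk_right (y := y))
    simp only [Function.comp_def] at this
    fun_prop
  rw [averageLikelihood, Ne, lintegral_eq_zero_iff hm]
  intro h
  have hF : ∀ᵐ _u ∂sphereUniform nc, False := h.mono fun u hu => by
    have := ENNReal.ofReal_pos.2 (Real.exp_pos (-s * misfit κ (codeword ρ u) y))
    exact this.ne' hu
  simp at hF
  exact IsProbabilityMeasure.ne_zero _ hF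

/-- Given the fading coefficient, the average over the inputs is a Bessel function. -/
lemma lintegral_exp_codeword {ρ s : ℝ} (hρ : 0 < ρ) (hs : 0 < s) {nc : ℕ} (hnc : 0 < nc)
    {y : Block nc} (hy : y ≠ 0) {h : ℂ} (hh : h ≠ 0) :
    ∫⁻ u, ENNReal.ofReal (Real.exp (-s * ‖y - h • codeword ρ u‖ ^ 2)) ∂sphereUniform nc
      = ENNReal.ofReal (Real.exp (-s * (‖y‖ ^ 2 + nc * ρ * ‖h‖ ^ 2))) *
        ENNReal.ofReal ((nc - 1).factorial *
          besselI (nc - 1) (2 * (s * Real.sqrt (nc * ρ) * ‖h‖ * ‖y‖)) /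
            (s * Real.sqrt (nc * ρ) * ‖h‖ * ‖y‖) ^ (nc - 1)) := by
  have hne : Nonempty (Fin nc) := ⟨⟨0, hnc⟩⟩
  have hfin : Module.finrank ℝ (Block nc) = 2 * (nc - 1 + 1) := by
    rw [← Module.finrank_mul_finrank ℝ ℂ (Block nc)]
    simp
    omega
  have hP : (0 : ℝ) < nc * ρ := by positivity
  set P : ℝ := nc * ρ
  set b : Block nc := ((s * Real.sqrt P : ℝ) : ℂ) • (starRingEnd ℂ) h • y with hb
  have hbn : ‖b‖ = s * Real.sqrt P * ‖h‖ * ‖y‖ := by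
    rw [hb, norm_smul, norm_smul, Complex.norm_real, Real.norm_of_nonneg (by positivity),
      RCLike.norm_conj]
    ring
  have hpt : ∀ u : Metric.sphere (0 : Block nc) 1,
      ENNReal.ofReal (Real.exp (-s * ‖y - h • codeword ρ u‖ ^ 2))
        = ENNReal.ofReal (Real.exp (-s * (‖y‖ ^ 2 + P * ‖h‖ ^ 2))) *
          ENNReal.ofReal (Real.exp (2 * inner ℝ b (u : Block nc))) := by
    intro u
    rw [← ENNReal.ofReal_mul (Real.exp_pos _).le, ← Real.exp_add, @norm_sub_sq ℂ, norm_smul, mul_pow,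
      norm_codeword_sq hρ, real_inner_eq_re, hb, codeword, inner_smul_left, inner_smul_left,
      inner_smul_right, inner_smul_right, Complex.conj_conj, Complex.conj_ofReal]
    have e : h * ((Real.sqrt P : ℂ) * inner ℂ y (u : Block nc))
        = (Real.sqrt P : ℂ) * (h * inner ℂ y (u : Block nc)) := by ring
    rw [e, Complex.re_ofReal_mul, RCLike.re_eq_complex_re, Complex.re_ofReal_mul]
    congr 2
    simp only [P]
    ring
  simp_rw [hpt]
  rw [lintegral_const_mul _ (by fun_prop), sphereUniform, lintegral_smul_measure,
    lintegral_exp_inner_sphere volume hfin (by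
      rw [hbn]
      have := norm_pos_iff.2 hy
      have := norm_pos_iff.2 hh
      positivity), hbn, smul_eq_mul, ← mul_assoc (_⁻¹), ENNReal.inv_mul_cancel, one_mul]
  · exact fun h => Measure.toSphere_ne_zero (volume : Measure (Block nc))
      (Measure.measure_univ_eq_zero.1 h)
  · exact measure_ne_top _ _

/-- The integrand of `besselIntegral`. -/
noncomputable def besselIntegrand (κ ρ : ℝ) (nc : ℕ) (s a z : ℝ) : ℝ :=
  Real.exp (-s * (ρ * nc + (sigmaH2 κ)⁻¹) * z) / (a * Real.sqrt (ρ * nc * z)) ^ (nc - 1)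
    * besselI (nc - 1) (2 * s * a * Real.sqrt (ρ * nc * z))
    * besselI 0 (2 * s * (sigmaH2 κ)⁻¹ * Real.sqrt (z * |muH κ| ^ 2))

/-- The factor that relates `averageLikelihood` to `besselIntegral`. -/
noncomputable def besselFactor (κ ρ : ℝ) (nc : ℕ) (s a : ℝ) : ℝ :=
  s * ((sigmaH2 κ)⁻¹ + nc * ρ) * Real.exp (-s * (muH κ ^ 2 / sigmaH2 κ + a ^ 2)) *
    ((nc - 1).factorial / s ^ (nc - 1))

/-- The averaged likelihood depends on `y` through `‖y‖` only, by way of `besselIntegral`. For `y = 0`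
the formula breaks down when `nc > 1`, as the integrand of `besselIntegral` then divides by zero. -/
lemma averageLikelihood_eq_lintegral {κ ρ s : ℝ} (hκ : 0 ≤ κ) (hρ : 0 < ρ) (hs : 0 < s) {nc : ℕ}
    (hnc : 0 < nc) {y : Block nc} (hy : y ≠ 0) :
    averageLikelihood κ ρ s y = ENNReal.ofReal (besselFactor κ ρ nc s ‖y‖) *
      ∫⁻ z in Set.Ioi (0 : ℝ), ENNReal.ofReal (besselIntegrand κ ρ nc s ‖y‖ z) := by
  have hprob := isProbabilityMeasure_sphereUniform hnc
  have hσ := sigmaH2_pos hκ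
  have hP : (0 : ℝ) < nc * ρ := by positivity
  have ha := norm_pos_iff.2 hy
  set P : ℝ := nc * ρ with hPdef
  set A : ℝ := (sigmaH2 κ)⁻¹ + P with hA
  have hA0 : 0 < A := by positivity
  have hmu : 0 ≤ muH κ := Real.sqrt_nonneg _
  set K : ℝ → ℝ := fun r => (nc - 1).factorial *
    besselI (nc - 1) (2 * (s * Real.sqrt P * r * ‖y‖)) / (s * Real.sqrt P * r * ‖y‖) ^ (nc - 1)
    with hK
  have hKm : Measurable K := by
    have := measurable_besselI (nc - 1)
    fun_prop
  set G : ℝ → ℝ≥0∞ := fun r => ENNReal.ofReal (Real.exp (-s * A * r ^ 2) * K r) with hG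
  have hGm : Measurable G := by fun_prop
  have hdouble : averageLikelihood κ ρ s y * ENNReal.ofReal (Real.pi / (s * A))
      = ∫⁻ h : ℂ, ENNReal.ofReal (Real.exp (-s * (‖h - (muH κ : ℂ)‖ ^ 2 / sigmaH2 κ))) *
        ∫⁻ u, ENNReal.ofReal (Real.exp (-s * ‖y - h • codeword ρ u‖ ^ 2)) ∂sphereUniform nc := by
    have hcw := (continuous_codeword ρ nc).measurable
    rw [averageLikelihood, ← lintegral_mul_const' _ _ ENNReal.ofReal_ne_top]
    have h1 : ∀ u : Metric.sphere (0 : Block nc) 1,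
        ENNReal.ofReal (Real.exp (-s * misfit κ (codeword ρ u) y)) *
          ENNReal.ofReal (Real.pi / (s * A))
        = ∫⁻ h : ℂ, ENNReal.ofReal (Real.exp (-s * (‖h - (muH κ : ℂ)‖ ^ 2 / sigmaH2 κ))) *
          ENNReal.ofReal (Real.exp (-s * ‖y - h • codeword ρ u‖ ^ 2)) := by
      intro u
      have h := lintegral_exp_fading hκ hs (codeword ρ u) y
      rw [norm_codeword_sq hρ] at h
      rw [mul_comm, ← h]
      refine lintegral_congr fun h => ?_
      rw [← ENNReal.ofReal_mul (Real.exp_pos _).le, ← Real.exp_add, mul_add]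
    simp_rw [h1]
    rw [lintegral_lintegral_swap (by fun_prop)]
    refine lintegral_congr fun h => ?_
    rw [lintegral_const_mul _ (by fun_prop)]
  have hinner : averageLikelihood κ ρ s y * ENNReal.ofReal (Real.pi / (s * A))
      = ENNReal.ofReal (Real.exp (-s * (muH κ ^ 2 / sigmaH2 κ + ‖y‖ ^ 2))) *
        ∫⁻ h : ℂ, G ‖h‖ * ENNReal.ofReal
          (Real.exp (2 * inner ℝ ((s * muH κ / sigmaH2 κ : ℝ) : ℂ) h)) := by
    rw [hdouble, ← lintegral_const_mul' _ _ ENNReal.ofReal_ne_top]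
    have h0 : ∀ᵐ h : ℂ, h ≠ 0 := compl_mem_ae_iff.2 (measure_singleton (0 : ℂ))
    refine lintegral_congr_ae (h0.mono fun h hh => ?_)
    simp only
    rw [lintegral_exp_codeword hρ hs hnc hy hh, hG]
    have hK0 : 0 ≤ K ‖h‖ := by
      have := besselI_nonneg (nc - 1) (x := 2 * (s * Real.sqrt P * ‖h‖ * ‖y‖)) (by positivity)
      simp only [hK]
      positivity
    change _ * (_ * ENNReal.ofReal (K ‖h‖)) = _
    simp only
    have hexp : Real.exp (-s * (‖h - (muH κ : ℂ)‖ ^ 2 / sigmaH2 κ)) *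
        Real.exp (-s * (‖y‖ ^ 2 + P * ‖h‖ ^ 2))
        = Real.exp (-s * (muH κ ^ 2 / sigmaH2 κ + ‖y‖ ^ 2)) * (Real.exp (-s * A * ‖h‖ ^ 2) *
          Real.exp (2 * inner ℝ ((s * muH κ / sigmaH2 κ : ℝ) : ℂ) h)) := by
      rw [← Real.exp_add, ← Real.exp_add, ← Real.exp_add, Complex.inner, Complex.sq_norm,
        Complex.normSq_sub, ← Complex.sq_norm, ← Complex.sq_norm, Complex.norm_real,
        Real.norm_eq_abs, sq_abs, Complex.conj_ofReal, Complex.conj_ofReal,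
        Complex.re_mul_ofReal, Complex.re_mul_ofReal, hA]
      congr 1
      field_simp
      ring
    rw [← ENNReal.ofReal_mul (by positivity), ← ENNReal.ofReal_mul (by positivity),
      ← ENNReal.ofReal_mul (by positivity), ← ENNReal.ofReal_mul (by positivity)]
    congr 1
    linear_combination K ‖h‖ * hexp
  have hpt : ∀ z ∈ Set.Ioi (0 : ℝ), G (Real.sqrt z) * ENNReal.ofReal (besselI 0
        (2 * (Real.sqrt z * ‖((s * muH κ / sigmaH2 κ : ℝ) : ℂ)‖)))
      = ENNReal.ofReal ((nc - 1).factorial / s ^ (nc - 1)) *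
        ENNReal.ofReal (besselIntegrand κ ρ nc s ‖y‖ z) := by
    intro z hz
    have hz0 : 0 < z := hz
    have e1 : Real.sqrt (ρ * nc * z) = Real.sqrt P * Real.sqrt z := by
      rw [← Real.sqrt_mul hP.le, hPdef]; ring_nf
    have e2 : Real.sqrt (z * |muH κ| ^ 2) = Real.sqrt z * muH κ := by
      rw [Real.sqrt_mul hz0.le, Real.sqrt_sq (abs_nonneg _), abs_of_nonneg hmu]
    have hB := besselI_nonneg (nc - 1) (x := 2 * (s * Real.sqrt P * Real.sqrt z * ‖y‖))
      (by positivity)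
    rw [hG, Complex.norm_real, Real.norm_of_nonneg (by positivity),
      ← ENNReal.ofReal_mul (by simp only [hK]; positivity), ← ENNReal.ofReal_mul (by positivity)]
    congr 1
    simp only [hK, besselIntegrand]
    rw [e1, e2, Real.sq_sqrt hz0.le,
      show 2 * s * ‖y‖ * (Real.sqrt P * Real.sqrt z) = 2 * (s * Real.sqrt P * Real.sqrt z * ‖y‖) by
        ring,
      show 2 * s * (sigmaH2 κ)⁻¹ * (Real.sqrt z * muH κ)
        = 2 * (Real.sqrt z * (s * muH κ / sigmaH2 κ)) by ring,
      show -s * (ρ * nc + (sigmaH2 κ)⁻¹) * z = -s * A * z by rw [hA, hPdef]; ring,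
      show s * Real.sqrt P * Real.sqrt z * ‖y‖ = s * (‖y‖ * (Real.sqrt P * Real.sqrt z)) by ring,
      mul_pow s]
    have hsz : 0 < ‖y‖ * (Real.sqrt P * Real.sqrt z) := by positivity
    field_simp
  have hpi : ENNReal.ofReal (Real.pi / (s * A)) ≠ 0 := by
    rw [Ne, ENNReal.ofReal_eq_zero, not_le]; positivity
  rw [← ENNReal.mul_left_inj hpi ENNReal.ofReal_ne_top, hinner,
    lintegral_complex_norm_mul_exp hGm, setLIntegral_congr_fun measurableSet_Ioi hpt,
    lintegral_const_mul' _ _ ENNReal.ofReal_ne_top, mul_right_comm (ENNReal.ofReal (besselFactor ..)),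
    ← mul_assoc, ← mul_assoc, ← ENNReal.ofReal_mul (by positivity),
    ← ENNReal.ofReal_mul (by positivity), ← ENNReal.ofReal_mul (by unfold besselFactor; positivity)]
  congr 2
  rw [besselFactor, ← hPdef, ← hA]
  field_simp

/-- The random variable `S` is the information density of tilted likelihoods. -/
lemma ofReal_exp_neg_S {κ ρ s : ℝ} (hκ : 0 ≤ κ) (hρ : 0 < ρ) (hs : 0 ≤ s) {nc : ℕ}
    (hnc : 0 < nc) {w : Block nc} (hw : wTilde κ ρ w ≠ 0) :
    ENNReal.ofReal (Real.exp (-S κ ρ s w))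
      = ENNReal.ofReal (Real.exp (s * ‖w‖ ^ 2)) * averageLikelihood κ ρ s (wTilde κ ρ w) := by
  rcases hs.eq_or_lt with rfl | hs
  · simp [S, averageLikelihood_zero κ ρ hnc]
  set y := wTilde κ ρ w
  have hσ := sigmaH2_pos hκ
  have hP : (0 : ℝ) < nc * ρ := by positivity
  have hnonneg : ∀ᵐ z ∂(volume.restrict (Set.Ioi (0 : ℝ))),
      0 ≤ besselIntegrand κ ρ nc s ‖y‖ z := by
    refine .of_forall fun z => ?_
    unfold besselIntegrand
    have h1 := besselI_nonneg (nc - 1) (x := 2 * s * ‖y‖ * Real.sqrt (ρ * nc * z)) (by positivity)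
    have h2 := besselI_nonneg 0 (x := 2 * s * (sigmaH2 κ)⁻¹ * Real.sqrt (z * |muH κ| ^ 2))
      (by positivity)
    positivity
  have hmeas : Measurable (besselIntegrand κ ρ nc s ‖y‖) := by
    have h1 := measurable_besselI (nc - 1)
    have h2 := measurable_besselI 0
    unfold besselIntegrand
    fun_prop
  have hB : besselIntegral κ ρ nc s ‖y‖
      = (∫⁻ z in Set.Ioi (0 : ℝ), ENNReal.ofReal (besselIntegrand κ ρ nc s ‖y‖ z)).toReal :=
    integral_eq_lintegral_of_nonneg_ae hnonneg hmeas.aestronglyMeasurable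
  have hZ := averageLikelihood_eq_lintegral hκ hρ hs hnc hw
  have hfac : 0 < besselFactor κ ρ nc s ‖y‖ := by unfold besselFactor; positivity
  have hZ0 := averageLikelihood_ne_zero hκ ρ s hnc y
  have hZt : averageLikelihood κ ρ s y ≠ ∞ :=
    ne_top_of_le_ne_top ENNReal.one_ne_top (averageLikelihood_le_one hκ ρ hs.le hnc y)
  have hL0 : ∫⁻ z in Set.Ioi (0 : ℝ), ENNReal.ofReal (besselIntegrand κ ρ nc s ‖y‖ z) ≠ 0 :=
    fun h => hZ0 (by rw [hZ, h, mul_zero])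
  have hLt : ∫⁻ z in Set.Ioi (0 : ℝ), ENNReal.ofReal (besselIntegrand κ ρ nc s ‖y‖ z) ≠ ∞ :=
    fun h => hZt (by rw [hZ, h, ENNReal.mul_top (ENNReal.ofReal_pos.2 hfac).ne'])
  have hBpos : 0 < besselIntegral κ ρ nc s ‖y‖ := by
    rw [hB]; exact ENNReal.toReal_pos hL0 hLt
  rw [hZ, ← ENNReal.ofReal_toReal hLt, ← hB, ← ENNReal.ofReal_mul hfac.le,
    ← ENNReal.ofReal_mul (Real.exp_pos _).le]
  congr 1
  have hlog : Real.log (besselFactor κ ρ nc s ‖y‖) = Real.log s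
      + Real.log ((1 + sigmaH2 κ * nc * ρ) / sigmaH2 κ) - s * (muH κ ^ 2 / sigmaH2 κ + ‖y‖ ^ 2)
      + Real.log (Real.Gamma nc) - ((nc : ℝ) - 1) * Real.log s := by
    have hA : (sigmaH2 κ)⁻¹ + nc * ρ = (1 + sigmaH2 κ * nc * ρ) / sigmaH2 κ := by field_simp
    have hA0 : 0 < (1 + sigmaH2 κ * nc * ρ) / sigmaH2 κ := by positivity
    have hfa : (0 : ℝ) < (nc - 1).factorial := by positivity
    obtain ⟨m, rfl⟩ : ∃ m, nc = m + 1 := ⟨nc - 1, by omega⟩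
    have hGam : Real.Gamma ((m + 1 : ℕ) : ℝ) = m.factorial := by
      push_cast; exact Real.Gamma_nat_eq_factorial m
    simp only [Nat.add_sub_cancel] at hfa
    rw [besselFactor, Nat.add_sub_cancel, hA, hGam, Real.log_mul (by positivity) (by positivity),
      Real.log_mul (by positivity) (by positivity), Real.log_mul (by positivity) (by positivity),
      Real.log_exp, Real.log_div (x := (m.factorial : ℝ)) (by positivity) (by positivity),
      Real.log_pow]
    push_cast
    ring
  rw [← Real.exp_log hfac, ← Real.exp_log hBpos, ← Real.exp_add, ← Real.exp_add, hlog, S,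
    if_neg hs.ne', sq_abs]
  congr 1
  simp only [y]
  ring

/-! ### Random coding with a minimum distance decoder -/

lemma exists_measurable_argmin {Y : Type*} [MeasurableSpace Y] (m : ℕ) :
    ∀ f : Fin (m + 1) → Y → ℝ, (∀ j, Measurable (f j)) →
      ∃ g : Y → Fin (m + 1), Measurable g ∧ ∀ y j, f (g y) y ≤ f j y := by
  induction m with
  | zero =>
    intro f _
    exact ⟨fun _ => 0, measurable_const, fun y j => by rw [Fin.fin_one_eq_zero j]⟩
  | succ m ih =>
    intro f hf
    obtain ⟨g, hg, hmin⟩ := ih (fun j => f j.castSucc) (fun j => hf _)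
    have hfg : Measurable (fun y => f (g y).castSucc y) := by
      have : Measurable (fun p : Fin (m + 1) × Y => f p.1.castSucc p.2) :=
        measurable_from_prod_countable_right fun j => hf j.castSucc
      exact this.comp (hg.prodMk measurable_id)
    refine ⟨fun y => if f (Fin.last _) y ≤ f (g y).castSucc y then Fin.last _ else (g y).castSucc,
      Measurable.ite (measurableSet_le (hf _) hfg) measurable_const
        ((measurable_of_countable Fin.castSucc).comp hg), fun y j => ?_⟩
    induction j using Fin.lastCases with
    | last => simp only; split_ifs with h; exacts [le_rfl, (not_le.1 h).le]
    | cast j => simp only; split_ifs with h; exacts [h.trans (hmin y j), hmin y j]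

section RandomCoding

set_option linter.unusedSectionVars false

variable {X Ω Y : Type*} [MeasurableSpace X] [MeasurableSpace Ω] [MeasurableSpace Y]

/-- The random coding union bound with `m` competing codewords: `chan x ω` is the channel output
for the input `x` and the channel state `ω`, and the decoder minimizes `d`. -/
noncomputable def unionBound (ν : Measure X) (P : Measure Ω) (chan : X → Ω → Y) (d : X → Y → ℝ)
    (m : ℕ) : ℝ≥0∞ :=
  ∫⁻ x, ∫⁻ ω, min 1 ((m : ℝ≥0∞) * ν {x' | d x' (chan x ω) ≤ d x (chan x ω)}) ∂P ∂ν

variable {ν : Measure X} {P : Measure Ω} [IsProbabilityMeasure ν] [IsProbabilityMeasure P]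
  {chan : X → Ω → Y} {d : X → Y → ℝ}

lemma lintegral_error_le_unionBound (hchan : Measurable (fun p : X × Ω => chan p.1 p.2))
    (hd : Measurable (fun p : X × Y => d p.1 p.2)) (m : ℕ) (j : Fin (m + 1)) :
    ∫⁻ c, P {ω | ∃ k, k ≠ j ∧ d (c k) (chan (c j) ω) ≤ d (c j) (chan (c j) ω)}
        ∂(Measure.pi fun _ : Fin (m + 1) => ν) ≤ unionBound ν P chan d m := by
  set ν' := Measure.pi fun _ : Fin m => ν
  have hset : MeasurableSet {q : (X × (Fin m → X)) × Ω |
      ∃ k, d (q.1.2 k) (chan q.1.1 q.2) ≤ d q.1.1 (chan q.1.1 q.2)} := by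
    have hc : Measurable (fun q : (X × (Fin m → X)) × Ω => chan q.1.1 q.2) :=
      hchan.comp (f := fun q : (X × (Fin m → X)) × Ω => (q.1.1, q.2)) (by fun_prop)
    have : ∀ k, MeasurableSet {q : (X × (Fin m → X)) × Ω |
        d (q.1.2 k) (chan q.1.1 q.2) ≤ d q.1.1 (chan q.1.1 q.2)} := fun k =>
      measurableSet_le (hd.comp (f := fun q : (X × (Fin m → X)) × Ω => (q.1.2 k, chan q.1.1 q.2))
        (by fun_prop)) (hd.comp (f := fun q : (X × (Fin m → X)) × Ω => (q.1.1, chan q.1.1 q.2))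
        (by fun_prop))
    simpa only [Set.ofPred_exists] using MeasurableSet.iUnion this
  set G : X × (Fin m → X) → ℝ≥0∞ := fun p =>
    P {ω | ∃ k, d (p.2 k) (chan p.1 ω) ≤ d p.1 (chan p.1 ω)} with hG
  have hGm : Measurable G := measurable_measure_prodMk_left hset
  have hmp := measurePreserving_piFinSuccAbove (fun _ : Fin (m + 1) => ν) j
  calc ∫⁻ c, P {ω | ∃ k, k ≠ j ∧ d (c k) (chan (c j) ω) ≤ d (c j) (chan (c j) ω)}
        ∂(Measure.pi fun _ : Fin (m + 1) => ν)
      = ∫⁻ c, G (MeasurableEquiv.piFinSuccAbove (fun _ => X) j c)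
          ∂(Measure.pi fun _ : Fin (m + 1) => ν) := by
        refine lintegral_congr fun c => ?_
        simp only [hG]
        congr 1
        ext ω
        constructor
        · rintro ⟨k, hk, h⟩
          obtain ⟨i, rfl⟩ := Fin.exists_succAbove_eq hk
          exact ⟨i, h⟩
        · rintro ⟨i, h⟩
          exact ⟨j.succAbove i, Fin.succAbove_ne j i, h⟩
    _ = ∫⁻ p, G p ∂(ν.prod ν') := hmp.lintegral_comp hGm
    _ = ∫⁻ x, ∫⁻ r, G (x, r) ∂ν' ∂ν := lintegral_prod _ hGm.aemeasurable
    _ ≤ unionBound ν P chan d m := by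
        refine lintegral_mono fun x => ?_
        have hx : MeasurableSet {q : (Fin m → X) × Ω |
            ∃ k, d (q.1 k) (chan x q.2) ≤ d x (chan x q.2)} :=
          hset.preimage (f := fun q : (Fin m → X) × Ω => ((x, q.1), q.2)) (by fun_prop)
        have hswap : ∫⁻ r, G (x, r) ∂ν'
            = ∫⁻ ω, ν' {r | ∃ k, d (r k) (chan x ω) ≤ d x (chan x ω)} ∂P :=
          (Measure.prod_apply hx).symm.trans (Measure.prod_apply_symm hx)
        rw [hswap]
        refine lintegral_mono fun ω => le_min prob_le_one ?_
        have hA : MeasurableSet {x' | d x' (chan x ω) ≤ d x (chan x ω)} :=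
          measurableSet_le (hd.comp measurable_prodMk_right) measurable_const
        simp only [Set.ofPred_exists]
        refine (measure_iUnion_le _).trans ?_
        rw [tsum_fintype]
        have hk : ∀ k : Fin m, ν' {r | d (r k) (chan x ω) ≤ d x (chan x ω)}
            = ν {x' | d x' (chan x ω) ≤ d x (chan x ω)} := fun k =>
          (measurePreserving_eval (fun _ : Fin m => ν) k).measure_preimage hA.nullMeasurableSet
        simp [hk]

/-- Some deterministic code does at least as well as the random code on average. -/
lemma exists_code_le_unionBound (hchan : Measurable (fun p : X × Ω => chan p.1 p.2))
    (hd : Measurable (fun p : X × Y => d p.1 p.2)) (m : ℕ) :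
    ∃ (c : Fin (m + 1) → X) (g : Y → Fin (m + 1)), Measurable g ∧
      ∑ j, P {ω | g (chan (c j) ω) ≠ j} ≤ (m + 1 : ℕ) * unionBound ν P chan d m := by
  set e : Fin (m + 1) → (Fin (m + 1) → X) → ℝ≥0∞ := fun j c =>
    P {ω | ∃ k, k ≠ j ∧ d (c k) (chan (c j) ω) ≤ d (c j) (chan (c j) ω)} with he
  have hem : ∀ j, Measurable (e j) := by
    intro j
    have hc : Measurable (fun q : (Fin (m + 1) → X) × Ω => chan (q.1 j) q.2) :=
      hchan.comp (f := fun q : (Fin (m + 1) → X) × Ω => (q.1 j, q.2)) (by fun_prop)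
    have hset : MeasurableSet {q : (Fin (m + 1) → X) × Ω |
        ∃ k, k ≠ j ∧ d (q.1 k) (chan (q.1 j) q.2) ≤ d (q.1 j) (chan (q.1 j) q.2)} := by
      simp only [Set.ofPred_exists, Set.ofPred_and]
      refine MeasurableSet.iUnion fun k => (MeasurableSet.const _).inter ?_
      exact measurableSet_le
        (hd.comp (f := fun q : (Fin (m + 1) → X) × Ω => (q.1 k, chan (q.1 j) q.2)) (by fun_prop))
        (hd.comp (f := fun q : (Fin (m + 1) → X) × Ω => (q.1 j, chan (q.1 j) q.2)) (by fun_prop))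
    exact measurable_measure_prodMk_left hset
  obtain ⟨c, hc⟩ := exists_le_lintegral (μ := Measure.pi fun _ : Fin (m + 1) => ν)
    (f := fun c => ∑ j, e j c) (by fun_prop)
  obtain ⟨g, hg, hmin⟩ := exists_measurable_argmin m (fun j y => d (c j) y)
    (fun j => hd.comp measurable_prodMk_left)
  refine ⟨c, g, hg, ?_⟩
  calc ∑ j, P {ω | g (chan (c j) ω) ≠ j} ≤ ∑ j, e j c :=
        Finset.sum_le_sum fun j _ => measure_mono fun ω hω => ⟨_, hω, hmin _ j⟩
    _ ≤ ∫⁻ c, ∑ j, e j c ∂(Measure.pi fun _ : Fin (m + 1) => ν) := hc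
    _ = ∑ j, ∫⁻ c, e j c ∂(Measure.pi fun _ : Fin (m + 1) => ν) :=
        lintegral_finsetSum _ fun j _ => hem j
    _ ≤ ∑ _j : Fin (m + 1), unionBound ν P chan d m :=
        Finset.sum_le_sum fun j _ => lintegral_error_le_unionBound hchan hd m j
    _ = (m + 1 : ℕ) * unionBound ν P chan d m := by simp

lemma unionBound_mono : Monotone (unionBound ν P chan d) := fun m n h =>
  lintegral_mono fun x => lintegral_mono fun ω => by gcongr

/-- If competing codewords beat the true one with positive probability, the union bound becomes
trivial as their number grows. -/
lemma exists_lt_unionBound (hchan : Measurable (fun p : X × Ω => chan p.1 p.2))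
    (hd : Measurable (fun p : X × Y => d p.1 p.2))
    (hpos : ∀ᵐ p ∂(ν.prod P), ν {x' | d x' (chan p.1 p.2) ≤ d p.1 (chan p.1 p.2)} ≠ 0)
    {ε : ℝ≥0∞} (hε : ε < 1) : ∃ N, ∀ m ≥ N, ε < unionBound ν P chan d m := by
  have hset : MeasurableSet {q : (X × Ω) × X |
      d q.2 (chan q.1.1 q.1.2) ≤ d q.1.1 (chan q.1.1 q.1.2)} := by
    have hc : Measurable (fun q : (X × Ω) × X => chan q.1.1 q.1.2) := hchan.comp measurable_fst
    exact measurableSet_le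
      (hd.comp (f := fun q : (X × Ω) × X => (q.2, chan q.1.1 q.1.2)) (by fun_prop))
      (hd.comp (f := fun q : (X × Ω) × X => (q.1.1, chan q.1.1 q.1.2)) (by fun_prop))
  set F : X × Ω → ℝ≥0∞ := fun p => ν {x' | d x' (chan p.1 p.2) ≤ d p.1 (chan p.1 p.2)} with hF
  have hFm : Measurable F := measurable_measure_prodMk_left hset
  have hUB : ∀ m, unionBound ν P chan d m = ∫⁻ p, min 1 ((m : ℝ≥0∞) * F p) ∂(ν.prod P) :=
    fun m => (lintegral_prod (fun p => min 1 ((m : ℝ≥0∞) * F p)) (by fun_prop)).symm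
  have hsup : ⨆ m, unionBound ν P chan d m = 1 := by
    simp_rw [hUB]
    rw [← lintegral_iSup (fun m => by fun_prop) (fun m n h p => by dsimp only; gcongr)]
    have h1 : ∀ᵐ p ∂(ν.prod P), ⨆ m : ℕ, min 1 ((m : ℝ≥0∞) * F p) = 1 := by
      filter_upwards [hpos] with p hp
      refine le_antisymm (iSup_le fun m => min_le_left _ _) ?_
      obtain ⟨m, hm⟩ := ENNReal.exists_nat_mul_gt hp ENNReal.one_ne_top
      exact le_iSup_of_le m (le_min le_rfl hm.le)
    rw [lintegral_congr_ae h1]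
    simp
  rw [← hsup, lt_iSup_iff] at hε
  obtain ⟨N, hN⟩ := hε
  exact ⟨N, fun m hm => hN.trans_le (unionBound_mono hm)⟩

end RandomCoding

/-- Almost every value of a random variable is such that an independent copy is at most as large with
positive probability. -/
lemma measure_setOf_measure_le_eq_zero {X : Type*} [MeasurableSpace X] (ν : Measure X)
    (T : X → ℝ) : ν {x | ν {x' | T x' ≤ T x} = 0} = 0 := by
  set A : Set ℝ := {t | ν {x' | T x' ≤ t} = 0} with hA
  -- `A` is a lower set, so it is a countable union of rays with rational ends, up to its maximum.
  have hsub : {x | ν {x' | T x' ≤ T x} = 0} ⊆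
      (⋃ q : {q : ℚ // (q : ℝ) ∈ A}, {x' | T x' ≤ (q.1 : ℝ)}) ∪
        {x | T x ∈ A ∧ ∀ t ∈ A, t ≤ T x} := by
    intro x hx
    by_cases h : ∀ t ∈ A, t ≤ T x
    · exact Or.inr ⟨hx, h⟩
    · push Not at h
      obtain ⟨t, ht, hlt⟩ := h
      obtain ⟨q, hq1, hq2⟩ := exists_rat_btwn hlt
      have hqA : (q : ℝ) ∈ A := measure_mono_null (fun x' hx' => le_trans hx' hq2.le) ht
      exact Or.inl (Set.mem_iUnion.2 ⟨⟨q, hqA⟩, hq1.le⟩)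
  refine measure_mono_null hsub (measure_union_null (measure_iUnion_null fun q => q.2) ?_)
  rcases Set.eq_empty_or_nonempty {x | T x ∈ A ∧ ∀ t ∈ A, t ≤ T x} with h | ⟨x, hx, hmax⟩
  · rw [h]; exact measure_empty
  · exact measure_mono_null (fun x' hx' => hmax _ hx'.1) hx

/-! ### The bound for the fading channel -/

/-- The law of the fading coefficients and of the noise. -/
noncomputable def stateLaw (κ : ℝ) (ℓ nc : ℕ) : Measure (Fin ℓ → ℂ × Block nc) :=
  Measure.pi (fun _ : Fin ℓ => (complexGaussian (muH κ : ℂ) (sigmaH2 κ)).prod (noise nc))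

instance (κ : ℝ) (ℓ nc : ℕ) : IsProbabilityMeasure (stateLaw κ ℓ nc) := by
  unfold stateLaw; infer_instance

/-- The law of a random codeword: independent and uniform in each block. -/
noncomputable def inputLaw (ℓ nc : ℕ) : Measure (Fin ℓ → Metric.sphere (0 : Block nc) 1) :=
  Measure.pi (fun _ : Fin ℓ => sphereUniform nc)

lemma isProbabilityMeasure_inputLaw (ℓ : ℕ) {nc : ℕ} (hnc : 0 < nc) :
    IsProbabilityMeasure (inputLaw ℓ nc) := by
  have := isProbabilityMeasure_sphereUniform hnc
  unfold inputLaw; infer_instance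

/-- The channel output for given directions of the input blocks and a given channel state. -/
noncomputable def channelOutput (ρ : ℝ) {ℓ nc : ℕ} (u : Fin ℓ → Metric.sphere (0 : Block nc) 1)
    (hw : Fin ℓ → ℂ × Block nc) : Fin ℓ → Block nc :=
  fun k => (hw k).1 • codeword ρ (u k) + (hw k).2

/-- The decoding metric: minus the logarithm of the likelihood, up to a constant. -/
noncomputable def totalMisfit (κ ρ : ℝ) {ℓ nc : ℕ} (u : Fin ℓ → Metric.sphere (0 : Block nc) 1)
    (y : Fin ℓ → Block nc) : ℝ :=
  ∑ k, misfit κ (codeword ρ (u k)) (y k)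

lemma measurable_channelOutput (ρ : ℝ) (ℓ nc : ℕ) :
    Measurable (fun p : (Fin ℓ → Metric.sphere (0 : Block nc) 1) × (Fin ℓ → ℂ × Block nc) =>
      channelOutput ρ p.1 p.2) := by
  have := (continuous_codeword ρ nc).measurable
  unfold channelOutput
  fun_prop

lemma measurable_totalMisfit {κ : ℝ} (hκ : 0 ≤ κ) (ρ : ℝ) (ℓ nc : ℕ) :
    Measurable (fun p : (Fin ℓ → Metric.sphere (0 : Block nc) 1) × (Fin ℓ → Block nc) =>
      totalMisfit κ ρ p.1 p.2) := by
  unfold totalMisfit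
  refine Finset.measurable_sum _ fun k _ => ?_
  exact (measurable_misfit_codeword hκ ρ nc).comp
    (f := fun p : (Fin ℓ → Metric.sphere (0 : Block nc) 1) × (Fin ℓ → Block nc) => (p.1 k, p.2 k))
    (by fun_prop)

lemma map_channelOutput (κ ρ : ℝ) {ℓ nc : ℕ} (u : Fin ℓ → Metric.sphere (0 : Block nc) 1) :
    (stateLaw κ ℓ nc).map (channelOutput ρ u)
      = Measure.pi (fun k => blockLaw κ (codeword ρ (u k))) := by
  unfold stateLaw channelOutput blockLaw
  exact Measure.pi_map_pi (f := fun k (hw : ℂ × Block nc) => hw.1 • codeword ρ (u k) + hw.2)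
    fun k => by fun_prop

/-- The ratio between the average tilted likelihood and the tilted likelihood of the input. -/
noncomputable def likelihoodRatio (κ ρ s : ℝ) {nc : ℕ} (u : Metric.sphere (0 : Block nc) 1)
    (y : Block nc) : ℝ≥0∞ :=
  ENNReal.ofReal (Real.exp (s * misfit κ (codeword ρ u) y)) * averageLikelihood κ ρ s y

lemma measurable_likelihoodRatio {κ : ℝ} (hκ : 0 ≤ κ) (ρ s : ℝ) {nc : ℕ} (hnc : 0 < nc)
    (u : Metric.sphere (0 : Block nc) 1) : Measurable (likelihoodRatio κ ρ s u) := by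
  have h1 := (measurable_misfit_codeword hκ ρ nc).comp (measurable_prodMk_left (x := u))
  have h2 := measurable_averageLikelihood hκ ρ s hnc
  simp only [Function.comp_def] at h1
  unfold likelihoodRatio
  fun_prop

lemma lintegral_pi_prod {X : Type*} [MeasurableSpace X] (ν : Measure X) [IsProbabilityMeasure ν]
    {ℓ : ℕ} {g : Fin ℓ → X → ℝ≥0∞} (hg : ∀ k, Measurable (g k)) :
    ∫⁻ x, ∏ k, g k (x k) ∂(Measure.pi fun _ : Fin ℓ => ν) = ∏ k, ∫⁻ v, g k v ∂ν := by
  rw [lintegral_prod_eq_prod_lintegral_of_indepFun Finset.univ (fun k (x : Fin ℓ → X) => g k (x k))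
    (iIndepFun_pi fun k => (hg k).aemeasurable) (fun k => (hg k).comp (measurable_pi_apply k))]
  exact Finset.prod_congr rfl fun k _ =>
    (measurePreserving_eval (fun _ : Fin ℓ => ν) k).lintegral_comp (hg k)

/-- Markov's inequality for the tilted likelihood of a competing codeword. -/
lemma inputLaw_le_prod_likelihoodRatio {κ ρ s : ℝ} (hκ : 0 ≤ κ) (hs : 0 ≤ s) {ℓ nc : ℕ}
    (hnc : 0 < nc) (u : Fin ℓ → Metric.sphere (0 : Block nc) 1) (y : Fin ℓ → Block nc) :
    inputLaw ℓ nc {u' | totalMisfit κ ρ u' y ≤ totalMisfit κ ρ u y}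
      ≤ ∏ k, likelihoodRatio κ ρ s (u k) (y k) := by
  have := isProbabilityMeasure_sphereUniform hnc
  have hmis : ∀ k, Measurable (fun v : Metric.sphere (0 : Block nc) 1 =>
      misfit κ (codeword ρ v) (y k)) := fun k => by
    have h := (measurable_misfit_codeword hκ ρ nc).comp (measurable_prodMk_right (y := y k))
    simpa only [Function.comp_def] using h
  have hprod : ∏ k, likelihoodRatio κ ρ s (u k) (y k)
      = ∫⁻ u', ∏ k, (ENNReal.ofReal (Real.exp (s * misfit κ (codeword ρ (u k)) (y k))) *
          ENNReal.ofReal (Real.exp (-s * misfit κ (codeword ρ (u' k)) (y k)))) ∂inputLaw ℓ nc := by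
    rw [inputLaw, lintegral_pi_prod (sphereUniform nc) (g := fun k v =>
      ENNReal.ofReal (Real.exp (s * misfit κ (codeword ρ (u k)) (y k))) *
        ENNReal.ofReal (Real.exp (-s * misfit κ (codeword ρ v) (y k))))
      (fun k => by have := hmis k; fun_prop)]
    refine Finset.prod_congr rfl fun k _ => ?_
    rw [lintegral_const_mul' _ _ ENNReal.ofReal_ne_top, likelihoodRatio, averageLikelihood]
  have hD : MeasurableSet {u' | totalMisfit κ ρ u' y ≤ totalMisfit κ ρ u y} :=
    measurableSet_le ((measurable_totalMisfit hκ ρ ℓ nc).comp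
      (f := fun u' : Fin ℓ → Metric.sphere (0 : Block nc) 1 => (u', y)) (by fun_prop))
      measurable_const
  rw [hprod, ← lintegral_indicator_one hD]
  refine lintegral_mono fun u' => ?_
  by_cases h : u' ∈ {u' | totalMisfit κ ρ u' y ≤ totalMisfit κ ρ u y}
  · rw [Set.indicator_of_mem h, Pi.one_apply]
    simp only [← ENNReal.ofReal_mul (Real.exp_pos _).le, ← Real.exp_add]
    rw [← ENNReal.ofReal_prod_of_nonneg fun k _ => (Real.exp_pos _).le, ← Real.exp_sum,
      ENNReal.one_le_ofReal, Real.one_le_exp_iff, Finset.sum_add_distrib, ← Finset.mul_sum,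
      ← Finset.mul_sum]
    have := mul_nonneg hs (sub_nonneg.2 (Set.mem_ofPred.1 h))
    unfold totalMisfit at this
    linarith
  · rw [Set.indicator_of_notMem h]
    exact zero_le

lemma averageLikelihood_unitary {κ ρ s : ℝ} (hκ : 0 ≤ κ) (hρ : 0 < ρ) (hs : 0 ≤ s) {nc : ℕ}
    (hnc : 0 < nc) (U : Block nc ≃ₗᵢ[ℂ] Block nc) {y : Block nc} (hy : y ≠ 0) :
    averageLikelihood κ ρ s (U y) = averageLikelihood κ ρ s y := by
  rcases hs.eq_or_lt with rfl | hs
  · rw [averageLikelihood_zero κ ρ hnc, averageLikelihood_zero κ ρ hnc]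
  · have hUy : U y ≠ 0 := by simpa using hy
    rw [averageLikelihood_eq_lintegral hκ hρ hs hnc hy,
      averageLikelihood_eq_lintegral hκ hρ hs hnc hUy, U.norm_map]

/-- The integrand of `errorBound`, without extended logarithms. -/
lemma exp_neg_max_sub_log (a : ℝ) (m : ℕ) :
    EReal.exp (-(max 0 ((a : EReal) - ENNReal.log (m : ℝ≥0∞))))
      = min 1 ((m : ℝ≥0∞) * ENNReal.ofReal (Real.exp (-a))) := by
  have hneg : -(max 0 ((a : EReal) - ENNReal.log (m : ℝ≥0∞)))
      = min 0 (ENNReal.log (m : ℝ≥0∞) + ((-a : ℝ) : EReal)) := by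
    rw [← neg_inj, neg_neg, ← EReal.max_neg_neg, neg_zero,
      EReal.neg_add (Or.inr (EReal.coe_ne_top _)) (Or.inr (EReal.coe_ne_bot _)), EReal.coe_neg,
      sub_eq_add_neg, sub_eq_add_neg, neg_neg, add_comm]
  rw [hneg, EReal.exp_monotone.map_min, EReal.exp_zero, EReal.exp_add, ENNReal.exp_log,
    EReal.exp_coe]

/-- For every codeword the union bound is controlled by the same expectation over the noise: all
points of the sphere are images of one another under unitary maps. -/
lemma lintegral_likelihoodRatio {κ ρ s : ℝ} (hκ : 0 ≤ κ) (hρ : 0 < ρ) (hs : 0 ≤ s) {ℓ nc : ℕ}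
    (hnc : 0 < nc) (m : ℕ) (u : Fin ℓ → Metric.sphere (0 : Block nc) 1) :
    ∫⁻ ω, min 1 ((m : ℝ≥0∞) * ∏ k, likelihoodRatio κ ρ s (u k) (channelOutput ρ u ω k))
        ∂stateLaw κ ℓ nc
      = ∫⁻ w : Fin ℓ → Block nc,
          EReal.exp (-(max 0 (((∑ k, S κ ρ s (w k) : ℝ) : EReal) - ENNReal.log (m : ℝ≥0∞))))
          ∂(Measure.pi (fun _ : Fin ℓ => noise nc)) := by
  choose U hU using fun k => exists_unitary_map_single hnc (norm_eq_of_mem_sphere (u k))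
  have hlaw : ∀ k, blockLaw κ (codeword ρ (u k))
      = (noise nc).map (fun w => U k (wTilde κ ρ w)) := by
    intro k
    rw [← blockLaw_eq_map_wTilde hκ hρ hnc (U k), hU k, codeword]
  have hUm : ∀ k, Measurable (fun w : Block nc => U k (wTilde κ ρ w)) := fun k =>
    ((U k).continuous.comp (continuous_wTilde κ ρ nc)).measurable
  have hpi : (stateLaw κ ℓ nc).map (channelOutput ρ u)
      = (Measure.pi (fun _ : Fin ℓ => noise nc)).map (fun w k => U k (wTilde κ ρ (w k))) := by
    rw [map_channelOutput]
    simp_rw [hlaw]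
    have : ∀ k, IsProbabilityMeasure ((noise nc).map (fun w => U k (wTilde κ ρ w))) := fun k =>
      Measure.isProbabilityMeasure_map (hUm k).aemeasurable
    exact (Measure.pi_map_pi (f := fun k w => U k (wTilde κ ρ w))
      fun k => (hUm k).aemeasurable).symm
  have hL := fun k => measurable_likelihoodRatio hκ ρ s hnc (u k)
  have hf : Measurable (fun y : Fin ℓ → Block nc =>
      min 1 ((m : ℝ≥0∞) * ∏ k, likelihoodRatio κ ρ s (u k) (y k))) := by
    have : Measurable (fun y : Fin ℓ → Block nc => ∏ k, likelihoodRatio κ ρ s (u k) (y k)) :=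
      Finset.measurable_prod _ fun k _ => (hL k).comp (measurable_pi_apply k)
    fun_prop
  have hout : Measurable (channelOutput ρ u (ℓ := ℓ) (nc := nc)) :=
    (measurable_channelOutput ρ ℓ nc).comp measurable_prodMk_left
  have hUpi : Measurable (fun (w : Fin ℓ → Block nc) k => U k (wTilde κ ρ (w k))) :=
    measurable_pi_lambda _ fun k => (hUm k).comp (measurable_pi_apply k)
  rw [← lintegral_map hf hout, hpi, lintegral_map hf hUpi]
  have hne : ∀ᵐ w ∂(Measure.pi (fun _ : Fin ℓ => noise nc)), ∀ k, wTilde κ ρ (w k) ≠ 0 := by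
    rw [ae_all_iff]
    exact fun k => (measurePreserving_eval (fun _ : Fin ℓ => noise nc) k).quasiMeasurePreserving.ae
      (ae_wTilde_ne_zero hκ hρ hnc)
  refine lintegral_congr_ae (hne.mono fun w hw => ?_)
  simp only
  rw [exp_neg_max_sub_log, ← Finset.sum_neg_distrib, Real.exp_sum,
    ENNReal.ofReal_prod_of_nonneg fun k _ => (Real.exp_pos _).le]
  congr 2
  refine Finset.prod_congr rfl fun k _ => ?_
  rw [ofReal_exp_neg_S hκ hρ hs hnc (hw k), likelihoodRatio,
    averageLikelihood_unitary hκ hρ hs hnc (U k) (hw k)]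
  have hcw : codeword ρ (u k)
      = U k ((Real.sqrt (nc * ρ) : ℂ) • EuclideanSpace.single ⟨0, hnc⟩ 1) := by
    rw [map_smul, hU k, codeword]
  rw [hcw, misfit_unitary, misfit_wTilde hκ hρ hnc]

lemma unionBound_le_errorBound {κ ρ : ℝ} (hκ : 0 ≤ κ) (hρ : 0 < ρ) {ℓ nc : ℕ} (hnc : 0 < nc)
    (m : ℕ) :
    unionBound (inputLaw ℓ nc) (stateLaw κ ℓ nc) (channelOutput ρ) (totalMisfit κ ρ) m
      ≤ errorBound κ ℓ nc (m + 1) ρ := by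
  have := isProbabilityMeasure_inputLaw ℓ hnc
  refine le_iInf₂ fun s hs => ?_
  rw [Nat.add_sub_cancel]
  calc unionBound (inputLaw ℓ nc) (stateLaw κ ℓ nc) (channelOutput ρ) (totalMisfit κ ρ) m
      ≤ ∫⁻ _u, ∫⁻ w : Fin ℓ → Block nc,
          EReal.exp (-(max 0 (((∑ k, S κ ρ s (w k) : ℝ) : EReal) - ENNReal.log (m : ℝ≥0∞))))
          ∂(Measure.pi (fun _ : Fin ℓ => noise nc)) ∂inputLaw ℓ nc := by
        refine lintegral_mono fun u => ?_
        rw [← lintegral_likelihoodRatio hκ hρ hs hnc m u]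
        refine lintegral_mono fun ω => ?_
        gcongr
        exact inputLaw_le_prod_likelihoodRatio hκ hs hnc u _
    _ = _ := by simp

/-- In one block, an independent input fits the output at least as well as the true one with
positive probability. -/
lemma ae_sphereUniform_misfit_ne_zero {κ : ℝ} (hκ : 0 ≤ κ) (ρ : ℝ) {nc : ℕ} (hnc : 0 < nc) :
    ∀ᵐ p ∂((sphereUniform nc).prod
        ((complexGaussian (muH κ : ℂ) (sigmaH2 κ)).prod (noise nc))),
      sphereUniform nc {v | misfit κ (codeword ρ v) (p.2.1 • codeword ρ p.1 + p.2.2)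
        ≤ misfit κ (codeword ρ p.1) (p.2.1 • codeword ρ p.1 + p.2.2)} ≠ 0 := by
  have := isProbabilityMeasure_sphereUniform hnc
  set F : Metric.sphere (0 : Block nc) 1 × Block nc → ℝ≥0∞ := fun q =>
    sphereUniform nc {v | misfit κ (codeword ρ v) q.2 ≤ misfit κ (codeword ρ q.1) q.2} with hF
  have hmis := measurable_misfit_codeword hκ ρ nc
  have hset : MeasurableSet {r : (Metric.sphere (0 : Block nc) 1 × Block nc) ×
      Metric.sphere (0 : Block nc) 1 |
        misfit κ (codeword ρ r.2) r.1.2 ≤ misfit κ (codeword ρ r.1.1) r.1.2} :=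
    measurableSet_le
      (hmis.comp (f := fun r : (Metric.sphere (0 : Block nc) 1 × Block nc) ×
        Metric.sphere (0 : Block nc) 1 => (r.2, r.1.2)) (by fun_prop))
      (hmis.comp measurable_fst)
  have hFm : Measurable F := measurable_measure_prodMk_left hset
  have hB : MeasurableSet {q | F q = 0} := hFm (measurableSet_singleton 0)
  -- First for an output that is independent of the input; absolute continuity does the rest.
  have hprod : ((sphereUniform nc).prod (volume : Measure (Block nc))) {q | F q = 0} = 0 := by
    rw [Measure.prod_apply_symm hB, lintegral_eq_zero_iff (measurable_measure_prodMk_right hB)]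
    exact .of_forall fun y => measure_setOf_measure_le_eq_zero (sphereUniform nc)
      (fun v => misfit κ (codeword ρ v) y)
  rw [Measure.measure_prod_null hB] at hprod
  have hcw := (continuous_codeword ρ nc).measurable
  have hm : Measurable (fun p : Metric.sphere (0 : Block nc) 1 × (ℂ × Block nc) =>
      (p.1, p.2.1 • codeword ρ p.1 + p.2.2)) := by fun_prop
  change _ = _
  have hB' := hB.preimage hm
  simp only [Set.compl_ofPred, not_not]
  change ((sphereUniform nc).prod _) ((fun p : Metric.sphere (0 : Block nc) 1 × (ℂ × Block nc) =>
      (p.1, p.2.1 • codeword ρ p.1 + p.2.2)) ⁻¹' {q | F q = 0}) = 0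
  rw [Measure.measure_prod_null hB']
  filter_upwards [hprod] with u hu
  have hac := blockLaw_absolutelyContinuous κ (codeword ρ u) hu
  rw [blockLaw, Measure.map_apply (by fun_prop) (measurable_prodMk_left hB)] at hac
  exact hac

lemma ae_inputLaw_totalMisfit_ne_zero {κ : ℝ} (hκ : 0 ≤ κ) (ρ : ℝ) (ℓ : ℕ) {nc : ℕ}
    (hnc : 0 < nc) :
    ∀ᵐ p ∂((inputLaw ℓ nc).prod (stateLaw κ ℓ nc)),
      inputLaw ℓ nc {u' | totalMisfit κ ρ u' (channelOutput ρ p.1 p.2)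
        ≤ totalMisfit κ ρ p.1 (channelOutput ρ p.1 p.2)} ≠ 0 := by
  have := isProbabilityMeasure_sphereUniform hnc
  have := isProbabilityMeasure_inputLaw ℓ hnc
  have hall : ∀ᵐ p ∂((inputLaw ℓ nc).prod (stateLaw κ ℓ nc)), ∀ k,
      sphereUniform nc {v | misfit κ (codeword ρ v) (channelOutput ρ p.1 p.2 k)
        ≤ misfit κ (codeword ρ (p.1 k)) (channelOutput ρ p.1 p.2 k)} ≠ 0 := by
    rw [ae_all_iff]
    intro k
    have hmp : MeasurePreserving (Prod.map (Function.eval k) (Function.eval k))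
        ((inputLaw ℓ nc).prod (stateLaw κ ℓ nc)) ((sphereUniform nc).prod
          ((complexGaussian (muH κ : ℂ) (sigmaH2 κ)).prod (noise nc))) :=
      (measurePreserving_eval (fun _ : Fin ℓ => sphereUniform nc) k).prod
        (measurePreserving_eval (fun _ : Fin ℓ =>
          (complexGaussian (muH κ : ℂ) (sigmaH2 κ)).prod (noise nc)) k)
    exact hmp.quasiMeasurePreserving.ae (ae_sphereUniform_misfit_ne_zero hκ ρ hnc)
  filter_upwards [hall] with p hp
  intro h0
  refine (Finset.prod_ne_zero_iff (s := Finset.univ).2 fun k _ => hp k) ?_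
  rw [← Measure.pi_pi]
  refine measure_mono_null (fun u' hu' => ?_) h0
  change totalMisfit κ ρ u' _ ≤ totalMisfit κ ρ p.1 _
  exact Finset.sum_le_sum fun k _ => Set.mem_ofPred.1 (hu' k (Set.mem_univ k))

lemma nonempty_code {κ : ℝ} (hκ : 0 ≤ κ) {ℓ nc : ℕ} (hnc : 0 < nc) {ε ρ : ℝ} (hε : 0 ≤ ε)
    (hρ : 0 < ρ) {M : ℕ} (hM : 1 ≤ M) (hbound : errorBound κ ℓ nc M ρ ≤ ENNReal.ofReal ε) :
    Nonempty (Code κ ℓ nc M ε ρ) := by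
  obtain ⟨m, rfl⟩ : ∃ m, M = m + 1 := ⟨M - 1, by omega⟩
  have := isProbabilityMeasure_inputLaw ℓ hnc
  obtain ⟨c, g, hg, hsum⟩ := exists_code_le_unionBound (ν := inputLaw ℓ nc)
    (P := stateLaw κ ℓ nc) (measurable_channelOutput ρ ℓ nc) (measurable_totalMisfit hκ ρ ℓ nc) m
  have hlaw : ∀ j, channelLaw κ (fun k => codeword ρ (c j k)) {y | g y ≠ j}
      = stateLaw κ ℓ nc {ω | g (channelOutput ρ (c j) ω) ≠ j} := by
    intro j
    have hout : Measurable (channelOutput ρ (c j)) :=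
      (measurable_channelOutput ρ ℓ nc).comp measurable_prodMk_left
    have hset : MeasurableSet {y | g y ≠ j} := (hg (measurableSet_singleton j)).compl
    exact Measure.map_apply hout hset
  refine ⟨⟨fun j k => codeword ρ (c j k), fun j k => norm_codeword_sq hρ _, g, hg, ?_⟩⟩
  have hle : ∑ j, channelLaw κ (fun k => codeword ρ (c j k)) {y | g y ≠ j}
      ≤ ENNReal.ofReal ((m + 1 : ℕ) * ε) := by
    simp_rw [hlaw]
    rw [ENNReal.ofReal_mul (by positivity), ENNReal.ofReal_natCast]
    exact hsum.trans (by gcongr; exact (unionBound_le_errorBound hκ hρ hnc m).trans hbound)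
  have hreal : ∑ j, (channelLaw κ (fun k => codeword ρ (c j k))).real {y | g y ≠ j}
      ≤ (m + 1 : ℕ) * ε := by
    simp only [measureReal_def]
    rw [← ENNReal.toReal_sum fun j _ => by rw [hlaw]; exact measure_ne_top _ _]
    exact ENNReal.toReal_le_of_le_ofReal (by positivity) hle
  rw [one_div, inv_mul_le_iff₀ (by positivity)]
  exact hreal

lemma errorBound_one (κ : ℝ) (ℓ nc : ℕ) (ρ : ℝ) : errorBound κ ℓ nc 1 ρ = 0 := by
  refine le_antisymm (iInf₂_le_of_le 0 le_rfl ?_) zero_le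
  simp_rw [Nat.sub_self, exp_neg_max_sub_log]
  simp

/-- Only finitely many code sizes are admissible. -/
lemma exists_bound_of_errorBound_le {κ : ℝ} (hκ : 0 ≤ κ) (ℓ : ℕ) {nc : ℕ} (hnc : 0 < nc) {ε ρ : ℝ}
    (hε : ε < 1) (hρ : 0 < ρ) :
    ∃ N, ∀ M, 1 ≤ M → errorBound κ ℓ nc M ρ ≤ ENNReal.ofReal ε → M ≤ N := by
  have := isProbabilityMeasure_inputLaw ℓ hnc
  obtain ⟨N, hN⟩ := exists_lt_unionBound (measurable_channelOutput ρ ℓ nc)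
    (measurable_totalMisfit hκ ρ ℓ nc) (ae_inputLaw_totalMisfit_ne_zero hκ ρ ℓ hnc)
    (ε := ENNReal.ofReal ε) (ENNReal.ofReal_lt_one.2 hε)
  refine ⟨N, fun M hM hle => ?_⟩
  by_contra! h
  obtain ⟨m, rfl⟩ : ∃ m, M = m + 1 := ⟨M - 1, by omega⟩
  exact absurd ((hN m (by omega)).trans_le (unionBound_le_errorBound hκ hρ hnc m)) (not_lt.2 hle)

end RicianBlockFading

theorem mainTheorem1 (κ : ℝ) (hκ : 0 ≤ κ) (ℓ nc : ℕ) (hℓ : 0 < ℓ) (hnc : 0 < nc)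
    (ε ρ : ℝ) (hε0 : 0 ≤ ε) (hε1 : ε < 1) (hρ : 0 < ρ) :
    ∃ r : ℝ,
      IsGreatest {R : ℝ | ∃ M : ℕ, 1 ≤ M ∧
        RicianBlockFading.errorBound κ ℓ nc M ρ ≤ ENNReal.ofReal ε ∧
        R = Real.logb 2 M / (nc * ℓ)} r ∧
      (r : EReal) ≤ RicianBlockFading.maxRate κ ℓ nc ε ρ := by
  obtain ⟨N, hN⟩ := RicianBlockFading.exists_bound_of_errorBound_le hκ ℓ hnc hε1 hρ
  set A : Set ℕ := {M | 1 ≤ M ∧ RicianBlockFading.errorBound κ ℓ nc M ρ ≤ ENNReal.ofReal ε}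
  have hA1 : A.Nonempty := ⟨1, le_rfl, by rw [RicianBlockFading.errorBound_one]; exact zero_le⟩
  have hA2 : BddAbove A := ⟨N, fun M hM => hN M hM.1 hM.2⟩
  obtain ⟨hM1, hM2⟩ : sSup A ∈ A := Nat.sSup_mem hA1 hA2
  refine ⟨Real.logb 2 (sSup A : ℕ) / (nc * ℓ), ⟨⟨sSup A, hM1, hM2, rfl⟩, ?_⟩, ?_⟩
  · rintro R ⟨M, h1, h2, rfl⟩
    have hle : M ≤ sSup A := le_csSup hA2 ⟨h1, h2⟩
    have hM : (0 : ℝ) < M := by exact_mod_cast h1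
    gcongr
    norm_num
  · refine le_sSup ⟨sSup A, RicianBlockFading.nonempty_code hκ hnc hε0 hρ hM1 hM2, ?_⟩
    rw [mul_comm (nc : ℝ)]
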